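/- Let $\mathbb K=\mathbb R$ or $\mathbb C$, let $n,r,s,m\ge 0$ be integers and let $\alpha>0$ be real. Write $\widehat{\mathbb A}_n^k$ for the space of $k$-tuples of formal power series in $x=(x_1,\dots,x_n)$ over $\mathbb K$, $G^{(i)}$ for the homogeneous part of degree $i$ of $G$, and put $\|g^{(i)}\|=\sum_{|Q|=i}|g_Q|$ for a scalar series $g=\sum_Q g_Qx^Q$ and $\|G^{(i)}\|=\max_l\|G_l^{(i)}\|$ for a tuple. The order of a series is the lowest degree of a nonzero term ($\infty$ for $0$), and the order of a tuple in $\widehat{\mathbb A}_n^s$ is the minimum of the orders of its components. For $k\ge 0$ let $\widehat{\mathcal F}^{>k}$ be the space of $F\in\widehat{\mathbb A}_n^r$ all of whose components have order $>m+k$; the order of $F\in\widehat{\mathcal F}^{>0}$ is measured in this filtration, i.e. it is $k+1$ if $F\in\widehat{\mathcal F}^{>k}\setminus\widehat{\mathcal F}^{>k+1}$. A map $A:\widehat{\mathcal F}^{>0}\to\widehat{\mathbb A}_n^s$ increases (resp. strictly increases) the order by $q$ if $\operatorname{ord}(A(F)-A(G))\ge \operatorname{ord}(F-G)+q$ (resp.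 $>$) for all $F\ne G$. Let $\mathcal S:\widehat{\mathcal F}^{>0}\to\widehat{\mathbb A}_n^s$ be linear, let $\pi:\widehat{\mathbb A}_n^s\to\widehat{\mathbb A}_n^s$ be a linear projection onto $\operatorname{Im}\mathcal S$, and let $\mathcal T:\widehat{\mathcal F}^{>0}\to\widehat{\mathbb A}_n^s$ be a map. Suppose that the triple $(\mathcal S,\mathcal T,\pi)$ has the relative big denominators property of order $m-\alpha<m$, i.e. that there is an integer $q\ge0$ such that: 1. $\mathcal T$ is a regular differential analytic map of order $(m,\dots,m)$: there is a germ at $0$ of an analytic map $W=(W_1,\dots,W_s)$ with $W(0)=0$ in the variables $x_1,\dots,x_n$ and $u_{j,a}$ ($1\le j\le r$, $a\in\mathbb N^n$, $|a|\le m$) such that $\mathcal T(F)=W(x,\partial F)$ for all $F\in\widehat{\mathcal F}^{>0}$, where $\partial F=(\partial^{|a|}F_j/\partial x^a)_{j,a}$, and $$\operatorname{ord}\Big(\frac{\partial W_i}{\partial u_{j,a}}(x,\partial F)\Big)\ \ge\ \max(0,|a|+q+1-m)$$ for all $F\in\widehat{\mathcal F}^{>0}$ and all $i,j,a$; 2.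 $\mathcal T$ strictly increases the order by $q$, and $\mathcal T(0)$ has order $>q$; 3. $\mathcal S$ increases the order by $q$; 4. $\mathcal S$ has a right inverse $\mathcal S^{-1}:\operatorname{Im}\mathcal S\to\widehat{\mathcal F}^{>0}$ for which there is a constant $C>0$ such that for every $G\in\widehat{\mathbb A}_n^s$ of order $\ge q+1$, all $1\le j\le r$ and all $i\ge1$, $$\big\|\big(\mathcal S_j^{-1}(\pi G)\big)^{(i+m)}\big\|\ \le\ C\,\frac{\|G^{(i+q)}\|}{i^{\,m-\alpha}} .$$ Then the equation $\mathcal S(F)=\pi(\mathcal T(F))$ has an $\alpha$-Gevrey formal solution: there is $F=(F_1,\dots,F_r)\in\widehat{\mathcal F}^{>0}$ with $\mathcal S(F)=\pi(\mathcal T(F))$ such that for each $j$ there are constants $M,C'>0$ with $|F_{j,Q}|\le M\,C'^{|Q|}(|Q|!)^{\alpha}$ for all $Q\in\mathbb N^n$, where $F_j=\sum_QF_{j,Q}x^Q$. -/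

import Mathlib

open MvPowerSeries

namespace BigDenominators

/-- Formal power series in `n` variables over `𝕜` (Taylor series of scalar objects). -/
abbrev FSeries (𝕜 : Type*) (n : ℕ) : Type _ := MvPowerSeries (Fin n) 𝕜

/-- `k`-tuples of formal power series in `n` variables. -/
abbrev FTuple (𝕜 : Type*) (n k : ℕ) : Type _ := Fin k → FSeries 𝕜 n

section Basic

variable {𝕜 : Type*} [RCLike 𝕜]

/-- `𝓕^{>i}`: the `r`-tuples of formal power series each of whose components has order
`> m + i` at the origin. -/
def filt (𝕜 : Type*) [RCLike 𝕜] (n r m i : ℕ) : Submodule 𝕜 (FTuple 𝕜 n r) where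
  carrier := {F | ∀ j, ((m + i : ℕ) : ℕ∞) < (F j).order}
  add_mem' := by
    intro F G hF hG j
    exact lt_of_lt_of_le (lt_min (hF j) (hG j)) (min_order_le_add (f := F j) (g := G j))
  zero_mem' := by
    intro j
    rw [Pi.zero_apply, order_zero]
    exact ENat.natCast_lt_top _
  smul_mem' := by
    intro c F hF j
    exact lt_of_lt_of_le (hF j) (le_order_smul (a := c) (f := F j))

/-- The space `𝓕^{>0}` of unknowns: all components have order `> m`. -/
abbrev Unknown (𝕜 : Type*) [RCLike 𝕜] (n r m : ℕ) : Type _ := filt 𝕜 n r m 0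

/-- The norm of the homogeneous part of degree `i` of a scalar series: the sum of the absolute
values of the coefficients of degree `i`. -/
noncomputable def homNorm {n : ℕ} (i : ℕ) (f : FSeries 𝕜 n) : ℝ :=
  ∑ Q ∈ Finset.finsuppAntidiag (Finset.univ : Finset (Fin n)) i, ‖coeff Q f‖

/-- The norm of the homogeneous part of degree `i` of a tuple: the maximum of the norms of the
homogeneous parts of its components (`0` for the empty tuple). -/
noncomputable def tupleHomNorm {n k : ℕ} (i : ℕ) (G : FTuple 𝕜 n k) : ℝ :=
  ⨆ l, homNorm i (G l)

/-- A power series that is the Taylor series of an analytic germ at the origin. -/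
def IsConvergent {σ : Type*} (f : MvPowerSeries σ 𝕜) : Prop :=
  ∃ M > (0 : ℝ), ∃ C > (0 : ℝ), ∀ Q : σ →₀ ℕ, ‖coeff Q f‖ ≤ M * C ^ Q.degree

/-- `α`-Gevrey formal power series. -/
def IsGevrey {n : ℕ} (α : ℝ) (f : FSeries 𝕜 n) : Prop :=
  ∃ M > (0 : ℝ), ∃ C > (0 : ℝ), ∀ Q : Fin n →₀ ℕ,
    ‖coeff Q f‖ ≤ M * C ^ Q.degree * ((Q.degree.factorial : ℕ) : ℝ) ^ α

/-- The formal partial derivative `∂^{|a|} f / ∂x^a`: its coefficient at `x^Q` is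
`((Q + a)! / Q!) f_{Q + a}`. -/
noncomputable def partialDeriv {n : ℕ} (a : Fin n →₀ ℕ) (f : FSeries 𝕜 n) : FSeries 𝕜 n :=
  fun Q => ((∏ k, (Q k + a k).descFactorial (a k) : ℕ) : 𝕜) * coeff (Q + a) f

/-- The coordinates `(x_1, …, x_n, u_{j,a})`, `1 ≤ j ≤ r`, `|a| ≤ m`, of the space of `m`-jets of
maps with `n` variables and `r` components. -/
abbrev JetVar (n r m : ℕ) : Type := Fin n ⊕ (Fin r × {a : Fin n →₀ ℕ // a.degree ≤ m})

/-- The formal jet `(x, ∂F)` of `F`, as a family of power series indexed by the jet coordinates. -/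
noncomputable def jet {n r : ℕ} (m : ℕ) (F : FTuple 𝕜 n r) : JetVar n r m → FSeries 𝕜 n
  | Sum.inl k => X k
  | Sum.inr (j, a) => partialDeriv a.1 (F j)

/-- The formal composition `w(x, ∂F)`. -/
noncomputable def compJet {n r m : ℕ} (w : MvPowerSeries (JetVar n r m) 𝕜) (F : FTuple 𝕜 n r) :
    FSeries 𝕜 n :=
  subst (jet m F) w

/-- For `F ∈ 𝓕^{>0}` the formal composition `w(x, ∂F)` makes sense. -/
theorem hasSubst_jet {n r m : ℕ} (F : Unknown 𝕜 n r m) : HasSubst (jet m F.1) := by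
  have hfin : Finite {a : Fin n →₀ ℕ // a.degree ≤ m} := Finsupp.finite_of_degree_le m
  refine hasSubst_of_constantCoeff_zero ?_
  rintro (k | ⟨j, a⟩)
  · simp [jet]
  · have h : coeff (0 + a.1) (F.1 j) = 0 := by
      refine coeff_of_lt_order (lt_of_le_of_lt ?_ (F.2 j))
      simpa using a.2
    change _ * coeff (0 + a.1) (F.1 j) = 0
    rw [h, mul_zero]

/-- `A` increases the order at the origin by `q`, that is `ord (A F - A G) ≥ ord (F - G) + q`,
where the order of an element of `𝓕^{>0}` is measured in the filtration `𝓕^{>k}`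
(elements of `𝓕^{>k}` have order at least `k + 1`). -/
def IncreasesOrder {n r m s : ℕ} (q : ℕ) (A : Unknown 𝕜 n r m → FTuple 𝕜 n s) : Prop :=
  ∀ (F G : Unknown 𝕜 n r m) (k : ℕ), F.1 - G.1 ∈ filt 𝕜 n r m k →
    ∀ i, ((k + 1 + q : ℕ) : ℕ∞) ≤ (A F i - A G i).order

/-- `A` strictly increases the order at the origin by `q`. -/
def StrictlyIncreasesOrder {n r m s : ℕ} (q : ℕ) (A : Unknown 𝕜 n r m → FTuple 𝕜 n s) : Prop :=
  ∀ (F G : Unknown 𝕜 n r m) (k : ℕ), F.1 - G.1 ∈ filt 𝕜 n r m k →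
    ∀ i, ((k + 1 + q : ℕ) : ℕ∞) < (A F i - A G i).order

/-- `T` is a regular differential analytic map of order `(m, …, m)`: `T F = W(x, ∂F)` for a germ
of analytic map `W` on the jet space with `W 0 = 0`, such that
`ord (∂W_i/∂u_{j,a})(x, ∂F) ≥ max (0, |a| + q + 1 - m)` for all formal `F ∈ 𝓕^{>0}`
(the subtraction below is the truncated one of `ℕ`). -/
def IsRegularDifferentialAnalytic {n r m s : ℕ} (q : ℕ)
    (T : Unknown 𝕜 n r m → FTuple 𝕜 n s) : Prop :=
  ∃ W : Fin s → MvPowerSeries (JetVar n r m) 𝕜,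
    (∀ i, IsConvergent (W i) ∧ constantCoeff (W i) = 0) ∧
    (∀ F i, T F i = compJet (W i) F.1) ∧
    ∀ (F : Unknown 𝕜 n r m) (i : Fin s) (j : Fin r) (a : {a : Fin n →₀ ℕ // a.degree ≤ m}),
      ((a.1.degree + q + 1 - m : ℕ) : ℕ∞) ≤
        (compJet (pderiv 𝕜 (Sum.inr (j, a)) (W i)) F.1).order

/-- The triple `(S, T, π)` has the relative big denominators property of order `m - α`. -/
def RelativeBigDenominators {n r m s : ℕ} (α : ℝ) (S : Unknown 𝕜 n r m →ₗ[𝕜] FTuple 𝕜 n s)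
    (T : Unknown 𝕜 n r m → FTuple 𝕜 n s) (π : FTuple 𝕜 n s →ₗ[𝕜] FTuple 𝕜 n s) : Prop :=
  ∃ q : ℕ,
    IsRegularDifferentialAnalytic q T ∧
    StrictlyIncreasesOrder q T ∧
    (∀ i, ((q : ℕ) : ℕ∞) < (T 0 i).order) ∧
    IncreasesOrder q S ∧
    LinearMap.IsProj (LinearMap.range S) π ∧
    -- a right inverse of `S` on its image (not required to be linear)
    ∃ Sinv : LinearMap.range S → Unknown 𝕜 n r m,
      (∀ y, S (Sinv y) = y.1) ∧
      ∃ C > (0 : ℝ), ∀ (G : FTuple 𝕜 n s), (∀ l, ((q : ℕ) : ℕ∞) < (G l).order) →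
        ∀ y : LinearMap.range S, y.1 = π G → ∀ (j : Fin r) (i : ℕ), 1 ≤ i →
          homNorm (i + m) ((Sinv y).1 j) ≤ C * tupleHomNorm (i + q) G / (i : ℝ) ^ ((m : ℝ) - α)

end Basic

end BigDenominators

/-! The right inverse of `S` need not be linear, so it is first made degreewise: its component of
degree `i + m` is recomputed from the homogeneous part of `G` of degree `i + q` alone
(`degreewise`). The estimate survives, and `S` still sends the result to `π G` (`map_degreewise`).
Since `T` strictly increases the order by `q`, composing with `T` contracts the filtration, and a
fixed point `F` solves the equation (`exists_fixedPoint`). It satisfies `‖F^{(i+m)}‖ ≤ C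
‖T(F)^{(i+q)}‖ / i^{m-α}`.

The Gevrey bound for `F` comes from weighted `ℓ¹` norms with `h k = u^k / (k!)^α`. Put `L = q + 1`
and write `F = P + G`, with `P` the part of degree at most `m + L`. The source norm gives degree `k
+ m` the weight `k^m h (k - L)`; the factor `k^m` pays for derivatives of order at most `m`. The
image norm gives degree `d ≥ 2L` the weight `h (d - 2L)`. Expanding `W` around the jet of `P`, two
or more jets of `G` account for the loss `2L`; a single jet accounts for `L`, and regularity of `W`
supplies the other `L`. Hence a source norm at most `1` bounds the image norm by a constant
independent of `h` (`exists_weightedSum_compJet_le`).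

In the big denominators estimate, degree `k + q` has image index one less than the source index of
degree `k + m`. The ratio of consecutive weights absorbs the remaining `k^α` and leaves a factor `u`
(`weightedSum_sourceWeight_le`). For small `u` the bound `1` therefore passes from one truncation of
`F` to the next (`isGevrey_of_homNorm_le`). -/

namespace BigDenominators

/-! ### Weighted `ℓ¹` norms: products, substitution, convergence -/

section WeightedSum

open scoped ENNReal

variable {𝕜 : Type*} [RCLike 𝕜] {σ τ : Type*}

/-- The weighted `ℓ¹`-norm `∑ ω(Q) |f_Q|` of a power series, with values in `[0, ∞]`. -/
noncomputable def weightedSum (ω : (σ →₀ ℕ) → ℝ≥0∞) (f : MvPowerSeries σ 𝕜) : ℝ≥0∞ :=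
  ∑' Q, ‖coeff Q f‖ₑ * ω Q

theorem weightedSum_le_mul {ω ω' : (σ →₀ ℕ) → ℝ≥0∞} {c : ℝ≥0∞} (f : MvPowerSeries σ 𝕜)
    (h : ∀ Q, coeff Q f ≠ 0 → ω Q ≤ c * ω' Q) : weightedSum ω f ≤ c * weightedSum ω' f := by
  rw [weightedSum, weightedSum, ← ENNReal.tsum_mul_left]
  refine ENNReal.tsum_le_tsum fun Q => ?_
  by_cases hQ : coeff Q f = 0
  · simp [hQ]
  · calc ‖coeff Q f‖ₑ * ω Q ≤ ‖coeff Q f‖ₑ * (c * ω' Q) := by gcongr; exact h Q hQ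
      _ = _ := by ring

theorem weightedSum_add_le (ω : (σ →₀ ℕ) → ℝ≥0∞) (f g : MvPowerSeries σ 𝕜) :
    weightedSum ω (f + g) ≤ weightedSum ω f + weightedSum ω g := by
  rw [weightedSum, weightedSum, weightedSum, ← ENNReal.tsum_add]
  refine ENNReal.tsum_le_tsum fun Q => ?_
  rw [← add_mul, map_add]
  gcongr
  exact enorm_add_le _ _

theorem weightedSum_monomial_one (ω : (σ →₀ ℕ) → ℝ≥0∞) (P : σ →₀ ℕ) :
    weightedSum ω (monomial P (1 : 𝕜)) = ω P := by
  classical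
  rw [weightedSum, tsum_eq_single P]
  · simp
  · intro Q hQ
    simp [coeff_monomial, hQ]

theorem weightedSum_one (ω : (σ →₀ ℕ) → ℝ≥0∞) :
    weightedSum ω (1 : MvPowerSeries σ 𝕜) = ω 0 :=
  weightedSum_monomial_one ω 0

theorem weightedSum_X (ω : (σ →₀ ℕ) → ℝ≥0∞) (y : σ) :
    weightedSum ω (X y : MvPowerSeries σ 𝕜) = ω (Finsupp.single y 1) :=
  weightedSum_monomial_one ω _

theorem weightedSum_mul_le {ω ω₁ ω₂ : (σ →₀ ℕ) → ℝ≥0∞} (h : ∀ P Q, ω (P + Q) ≤ ω₁ P * ω₂ Q)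
    (f g : MvPowerSeries σ 𝕜) :
    weightedSum ω (f * g) ≤ weightedSum ω₁ f * weightedSum ω₂ g := by
  classical
  have key : ∀ Q, ‖coeff Q (f * g)‖ₑ * ω Q ≤ ∑' p : Finset.HasAntidiagonal.antidiagonal Q,
      (‖coeff p.1.1 f‖ₑ * ω₁ p.1.1) * (‖coeff p.1.2 g‖ₑ * ω₂ p.1.2) := by
    intro Q
    rw [coeff_mul, tsum_fintype, Finset.univ_eq_attach, Finset.sum_attach (Finset.HasAntidiagonal.antidiagonal Q)
      (fun p => (‖coeff p.1 f‖ₑ * ω₁ p.1) * (‖coeff p.2 g‖ₑ * ω₂ p.2))]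
    calc _ ≤ (∑ p ∈ Finset.HasAntidiagonal.antidiagonal Q, ‖coeff p.1 f * coeff p.2 g‖ₑ) * ω Q := by
            gcongr; exact enorm_sum_le _ _
      _ = ∑ p ∈ Finset.HasAntidiagonal.antidiagonal Q, ‖coeff p.1 f * coeff p.2 g‖ₑ * ω Q := Finset.sum_mul ..
      _ ≤ _ := by
            refine Finset.sum_le_sum fun p hp => ?_
            rw [Finset.HasAntidiagonal.mem_antidiagonal] at hp
            rw [enorm_mul, ← hp]
            calc _ ≤ ‖coeff p.1 f‖ₑ * ‖coeff p.2 g‖ₑ * (ω₁ p.1 * ω₂ p.2) := by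
                    gcongr; exact h _ _
              _ = _ := by ring
  calc weightedSum ω (f * g) ≤ ∑' Q, ∑' p : Finset.HasAntidiagonal.antidiagonal Q,
        (‖coeff p.1.1 f‖ₑ * ω₁ p.1.1) * (‖coeff p.1.2 g‖ₑ * ω₂ p.1.2) :=
        ENNReal.tsum_le_tsum key
    _ = ∑' x : (Σ Q : σ →₀ ℕ, Finset.HasAntidiagonal.antidiagonal Q),
        (‖coeff x.2.1.1 f‖ₑ * ω₁ x.2.1.1) * (‖coeff x.2.1.2 g‖ₑ * ω₂ x.2.1.2) :=
        (ENNReal.tsum_sigma'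
          (fun x : (Σ Q : σ →₀ ℕ, Finset.HasAntidiagonal.antidiagonal Q) =>
            (‖coeff x.2.1.1 f‖ₑ * ω₁ x.2.1.1) * (‖coeff x.2.1.2 g‖ₑ * ω₂ x.2.1.2))).symm
    _ = ∑' p : (σ →₀ ℕ) × (σ →₀ ℕ),
        (‖coeff p.1 f‖ₑ * ω₁ p.1) * (‖coeff p.2 g‖ₑ * ω₂ p.2) :=
        Finset.HasAntidiagonal.sigmaAntidiagonalEquivProd.tsum_eq
          (fun p : (σ →₀ ℕ) × (σ →₀ ℕ) => (‖coeff p.1 f‖ₑ * ω₁ p.1) * (‖coeff p.2 g‖ₑ * ω₂ p.2))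
    _ = _ := by
        rw [ENNReal.tsum_prod']
        simp_rw [ENNReal.tsum_mul_left, ENNReal.tsum_mul_right]
        rfl

theorem weightedSum_subst_le (ω : (τ →₀ ℕ) → ℝ≥0∞) {a : σ → MvPowerSeries τ 𝕜} (ha : HasSubst a)
    (f : MvPowerSeries σ 𝕜) :
    weightedSum ω (subst a f) ≤
      ∑' d, ‖coeff d f‖ₑ * weightedSum ω (d.prod fun y k => a y ^ k) := by
  have key : ∀ Q, ‖coeff Q (subst a f)‖ₑ * ω Q ≤
      ∑' d, ‖coeff d f‖ₑ * (‖coeff Q (d.prod fun y k => a y ^ k)‖ₑ * ω Q) := by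
    intro Q
    rw [coeff_subst ha, finsum_eq_sum _ (coeff_subst_finite ha f Q)]
    simp_rw [← mul_assoc]
    rw [ENNReal.tsum_mul_right]
    gcongr
    refine (enorm_sum_le _ _).trans ?_
    simp_rw [smul_eq_mul, enorm_mul]
    exact ENNReal.sum_le_tsum _
  refine (ENNReal.tsum_le_tsum key).trans ?_
  rw [ENNReal.tsum_comm]
  simp_rw [ENNReal.tsum_mul_left]
  rfl

/-- The weight may depend on the monomial `R` being substituted into, so each variable is measured
in its own weight; submultiplicativity jointly in `R` and the exponent is all that is needed. -/
theorem weightedSum_prod_le {Ω : (σ →₀ ℕ) → (τ →₀ ℕ) → ℝ≥0∞} (h0 : Ω 0 0 ≤ 1)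
    (hadd : ∀ R₁ R₂ P Q, Ω (R₁ + R₂) (P + Q) ≤ Ω R₁ P * Ω R₂ Q) (a : σ → MvPowerSeries τ 𝕜)
    (R : σ →₀ ℕ) :
    weightedSum (Ω R) (R.prod fun y k => a y ^ k) ≤
      R.prod fun y k => weightedSum (Ω (Finsupp.single y 1)) (a y) ^ k := by
  classical
  induction R using Finsupp.induction_linear with
  | zero => simpa [weightedSum_one] using h0
  | add f g hf hg =>
    rw [Finsupp.prod_add_index' (by simp) (by intros; rw [pow_add]),
      Finsupp.prod_add_index' (by simp) (by intros; rw [pow_add])]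
    exact (weightedSum_mul_le (hadd f g) _ _).trans (mul_le_mul' hf hg)
  | single y k =>
    rw [Finsupp.prod_single_index (by simp), Finsupp.prod_single_index (by simp)]
    induction k with
    | zero => simpa [weightedSum_one] using h0
    | succ k ih =>
      rw [pow_succ, pow_succ, Finsupp.single_add]
      exact (weightedSum_mul_le (hadd _ _) _ _).trans (mul_le_mul' ih le_rfl)

/-- The sum is dominated by a product of geometric series, one per variable; the induction enlarges
the set of variables allowed in the support. -/
theorem tsum_pow_degree_ne_top [Finite σ] {t : ℝ≥0∞} (ht : t < 1) :
    ∑' d : σ →₀ ℕ, t ^ d.degree ≠ ∞ := by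
  classical
  have := Fintype.ofFinite σ
  have key : ∀ s : Finset σ, (∑' d : σ →₀ ℕ, if d.support ⊆ s then t ^ d.degree else 0) ≤
      (∑' k : ℕ, t ^ k) ^ s.card := by
    intro s
    induction s using Finset.induction_on with
    | empty =>
      rw [tsum_eq_single 0]
      · simp
      · intro d hd
        simp [hd]
    | insert y s hy ih =>
      have hinj : Function.Injective (fun d : σ →₀ ℕ => (d y, d.erase y)) := by
        intro d d' h
        simp only [Prod.mk.injEq] at h
        rw [← Finsupp.single_add_erase y d, ← Finsupp.single_add_erase y d', h.1, h.2]
      rw [Finset.card_insert_of_notMem hy, pow_succ']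
      calc _ ≤ ∑' d : σ →₀ ℕ, (fun p : ℕ × (σ →₀ ℕ) => t ^ p.1 *
            if p.2.support ⊆ s then t ^ p.2.degree else 0) (d y, d.erase y) := by
            refine ENNReal.tsum_le_tsum fun d => ?_
            split_ifs with h
            · have h' : (d.erase y).support ⊆ s := by
                rw [Finsupp.support_erase]
                intro z hz
                rw [Finset.mem_erase] at hz
                exact Finset.mem_of_mem_insert_of_ne (h hz.2) hz.1
              have hd : d.degree = d y + (d.erase y).degree := by
                conv_lhs => rw [← Finsupp.single_add_erase y d]
                rw [map_add, Finsupp.degree_single]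
              simp only [h', if_true]
              rw [hd, pow_add]
            · exact zero_le
        _ ≤ ∑' p : ℕ × (σ →₀ ℕ), t ^ p.1 * if p.2.support ⊆ s then t ^ p.2.degree else 0 :=
            ENNReal.tsum_comp_le_tsum_of_injective hinj _
        _ = (∑' k : ℕ, t ^ k) *
            ∑' d : σ →₀ ℕ, if d.support ⊆ s then t ^ d.degree else 0 := by
            rw [ENNReal.tsum_prod']
            simp_rw [ENNReal.tsum_mul_left, ENNReal.tsum_mul_right]
        _ ≤ _ := by gcongr
  have h := key Finset.univ
  simp only [Finset.subset_univ, if_true] at h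
  refine ne_top_of_le_ne_top (ENNReal.pow_ne_top ?_) h
  rw [ENNReal.tsum_geometric]
  exact ENNReal.inv_ne_top.mpr (tsub_pos_of_lt ht).ne'

/-- The weighted norm with weights `ρ ^ |Q|`. -/
noncomputable abbrev radiusSum (ρ : ℝ≥0∞) (f : MvPowerSeries σ 𝕜) : ℝ≥0∞ :=
  weightedSum (fun Q => ρ ^ Q.degree) f

theorem IsConvergent.exists_radiusSum_ne_top [Finite σ] {f : MvPowerSeries σ 𝕜}
    (hf : IsConvergent f) : ∃ ρ : ℝ≥0∞, ρ ≠ 0 ∧ radiusSum ρ f ≠ ∞ := by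
  obtain ⟨M, hM, C, hC, h⟩ := hf
  -- The radius `1 / (2C)` turns the Cauchy bound into a geometric series of ratio `1/2`.
  refine ⟨ENNReal.ofReal (C⁻¹ * 2⁻¹), by simp [hC], ?_⟩
  have ht : ENNReal.ofReal (2⁻¹ : ℝ) < 1 := by
    rw [← ENNReal.ofReal_one]
    exact (ENNReal.ofReal_lt_ofReal_iff one_pos).mpr (by norm_num)
  refine ne_top_of_le_ne_top
    (ENNReal.mul_ne_top (ENNReal.ofReal_ne_top (r := M)) (tsum_pow_degree_ne_top (σ := σ) ht)) ?_
  rw [← ENNReal.tsum_mul_left]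
  refine ENNReal.tsum_le_tsum fun Q => ?_
  beta_reduce
  rw [← ofReal_norm, ← ENNReal.ofReal_pow (by positivity),
    ← ENNReal.ofReal_pow (by positivity), ← ENNReal.ofReal_mul (by positivity),
    ← ENNReal.ofReal_mul (by positivity)]
  refine ENNReal.ofReal_le_ofReal ?_
  calc _ ≤ M * C ^ Q.degree * (C⁻¹ * 2⁻¹) ^ Q.degree := by gcongr; exact h Q
    _ = M * 2⁻¹ ^ Q.degree * (C * C⁻¹) ^ Q.degree := by rw [mul_pow, mul_pow]; ring
    _ = _ := by rw [mul_inv_cancel₀ hC.ne', one_pow, mul_one]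

theorem radiusSum_subst_le {a : σ → MvPowerSeries τ 𝕜} (ha : HasSubst a) {ρ ρ' : ℝ≥0∞}
    (h : ∀ y, radiusSum ρ (a y) ≤ ρ') (f : MvPowerSeries σ 𝕜) :
    radiusSum ρ (subst a f) ≤ radiusSum ρ' f := by
  refine (weightedSum_subst_le _ ha f).trans (ENNReal.tsum_le_tsum fun d => ?_)
  gcongr
  refine (weightedSum_prod_le (Ω := fun _ Q => ρ ^ Q.degree) (by simp)
    (fun _ _ P Q => by rw [map_add, pow_add]) a d).trans ?_
  beta_reduce
  rw [Finsupp.degree_apply, ← Finset.prod_pow_eq_pow_sum]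
  exact Finset.prod_le_prod' fun y _ => pow_le_pow_left' (h y) _

theorem radiusSum_le_mul {ρ : ℝ≥0∞} (hρ : ρ ≤ 1) {f : MvPowerSeries σ 𝕜}
    (hf : constantCoeff f = 0) : radiusSum ρ f ≤ ρ * radiusSum 1 f := by
  refine weightedSum_le_mul f fun Q hQ => ?_
  have : 1 ≤ Q.degree := by
    rw [Nat.one_le_iff_ne_zero, Ne, Finsupp.degree_eq_zero_iff]
    rintro rfl
    exact hQ hf
  simpa using pow_le_pow_right_of_le_one' hρ this

end WeightedSum

/-! ### Taylor expansion in the jet variables around a given jet -/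

section Translate

open scoped ENNReal

variable {𝕜 : Type*} [RCLike 𝕜] {σ τ ι : Type*}

/-- The chain rule when only `a b` involves the variable `c`, with derivative `1`. Monomials without
`b` contribute nothing, and the others are reindexed by adding one factor `b`. -/
theorem pderiv_subst_of_pderiv_eq_single [DecidableEq σ] {a : σ → MvPowerSeries τ 𝕜}
    (ha : HasSubst a) {b : σ} {c : τ} (h : ∀ y, pderiv 𝕜 c (a y) = if y = b then 1 else 0)
    (f : MvPowerSeries σ 𝕜) : pderiv 𝕜 c (subst a f) = subst a (pderiv 𝕜 b f) := by
  have hprod0 : ∀ d : σ →₀ ℕ, d b = 0 → pderiv 𝕜 c (d.prod fun y k => a y ^ k) = 0 := by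
    intro d hd
    refine Finset.prod_induction _ (fun g => pderiv 𝕜 c g = 0) ?_ (pderiv_one) ?_
    · intro g₁ g₂ h₁ h₂
      rw [Derivation.leibniz, h₁, h₂, smul_zero, smul_zero, add_zero]
    · intro y hy
      have hyb : y ≠ b := by
        rintro rfl
        exact Finsupp.mem_support_iff.mp hy hd
      rw [pderiv_pow, h, if_neg hyb, mul_zero]
  have hprod : ∀ d : σ →₀ ℕ, pderiv 𝕜 c ((d + Finsupp.single b 1).prod fun y k => a y ^ k) =
      ((d b + 1 : ℕ) : 𝕜) • d.prod fun y k => a y ^ k := by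
    intro d
    have hadd : ∀ d₁ d₂ : σ →₀ ℕ, ((d₁ + d₂).prod fun y k => a y ^ k) =
        (d₁.prod fun y k => a y ^ k) * d₂.prod fun y k => a y ^ k := fun d₁ d₂ =>
      Finsupp.prod_add_index' (by simp) (by intros; rw [pow_add])
    have hsingle : ∀ k, ((Finsupp.single b k).prod fun y k => a y ^ k) = a b ^ k := fun k =>
      Finsupp.prod_single_index (pow_zero _)
    have hd : d + Finsupp.single b 1 = Finsupp.single b (d b + 1) + d.erase b := by
      rw [Finsupp.single_add, add_right_comm, Finsupp.single_add_erase]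
    rw [hd, hadd, Derivation.leibniz, hprod0 _ Finsupp.erase_same,
      hsingle, pderiv_pow, h, if_pos rfl]
    conv_rhs => rw [← Finsupp.single_add_erase b d, hadd, hsingle]
    rw [Nat.cast_smul_eq_nsmul 𝕜, nsmul_eq_mul]
    simp only [smul_eq_mul, Finsupp.coe_add, Pi.add_apply, Finsupp.single_eq_same,
      Finsupp.erase_same, add_zero, Nat.add_sub_cancel, mul_one]
    ring
  ext R
  rw [coeff_pderiv, coeff_subst ha, coeff_subst ha, finsum_mul' _ _ (coeff_subst_finite ha f _)]
  have hterm : ∀ d : σ →₀ ℕ,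
      coeff d f • coeff (R + Finsupp.single c 1) (d.prod fun y k => a y ^ k) * ((R c : 𝕜) + 1) =
        coeff d f * coeff R (pderiv 𝕜 c (d.prod fun y k => a y ^ k)) := by
    intro d
    rw [coeff_pderiv, smul_eq_mul, mul_assoc]
  simp_rw [hterm]
  have hinj : Function.Injective (fun d : σ →₀ ℕ => d + Finsupp.single b 1) :=
    add_left_injective _
  have hsupp : ∀ d : σ →₀ ℕ, d ∉ (Set.range fun d : σ →₀ ℕ => d + Finsupp.single b 1) →
      coeff d f * coeff R (pderiv 𝕜 c (d.prod fun y k => a y ^ k)) = 0 := by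
    intro d hd
    rw [hprod0, map_zero, mul_zero]
    by_contra hdb
    exact hd ⟨d - Finsupp.single b 1, tsub_add_cancel_of_le (by
      rw [Finsupp.single_le_iff]; omega)⟩
  rw [← Set.indicator_eq_self.mpr (Function.support_subset_iff'.mpr hsupp), ← finsum_mem_def,
    finsum_mem_range hinj]
  refine finsum_congr fun d => ?_
  rw [hprod, coeff_pderiv, map_smul, smul_eq_mul, smul_eq_mul]
  push_cast
  ring

theorem prod_X_pow (d : σ →₀ ℕ) :
    (d.prod fun y k => (X y : MvPowerSeries σ 𝕜) ^ k) = monomial d 1 := by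
  have h := subst_monomial (R := 𝕜) (S := 𝕜) (HasSubst.X (σ := σ)) d 1
  rw [map_one (algebraMap 𝕜 _), one_mul] at h
  exact h.symm.trans (congrFun subst_self _)

theorem prod_X_inl_pow (d : σ →₀ ℕ) :
    (d.prod fun y k => (X (Sum.inl y) : MvPowerSeries (σ ⊕ ι) 𝕜) ^ k) =
      monomial (Finsupp.sumElim d 0) 1 := by
  rw [← prod_X_pow, Finsupp.prod_sumElim, Finsupp.prod_zero_index, mul_one]
  rfl

/-- The substitution `(x, u) ↦ (x, u + p(x))`. -/
noncomputable def shift (p : ι → MvPowerSeries σ 𝕜) : σ ⊕ ι → MvPowerSeries (σ ⊕ ι) 𝕜 :=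
  Sum.elim (fun k => X (Sum.inl k))
    (fun b => X (Sum.inr b) + subst (fun k => (X (Sum.inl k) : MvPowerSeries (σ ⊕ ι) 𝕜)) (p b))

/-- The series `W(x, u + p(x))` in the variables `(x, u)`. -/
noncomputable def translate (p : ι → MvPowerSeries σ 𝕜) (W : MvPowerSeries (σ ⊕ ι) 𝕜) :
    MvPowerSeries (σ ⊕ ι) 𝕜 :=
  subst (shift p) W

variable [Finite σ]

theorem hasSubst_X_inl : HasSubst fun k : σ => (X (Sum.inl k) : MvPowerSeries (σ ⊕ ι) 𝕜) :=
  hasSubst_of_constantCoeff_zero fun _ => by simp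

theorem constantCoeff_shift {p : ι → MvPowerSeries σ 𝕜} (hp : ∀ b, constantCoeff (p b) = 0)
    (y : σ ⊕ ι) : constantCoeff (shift p y) = 0 := by
  rcases y with k | b
  · simp [shift]
  · simp only [shift, Sum.elim_inr, map_add, constantCoeff_X, zero_add]
    exact constantCoeff_subst_eq_zero hasSubst_X_inl (fun _ => by simp) (hp b)

theorem coeff_subst_X_inl_eq_zero (f : MvPowerSeries σ 𝕜) {R : σ ⊕ ι →₀ ℕ} {b : ι}
    (hR : R (Sum.inr b) ≠ 0) :
    coeff R (subst (fun k => (X (Sum.inl k) : MvPowerSeries (σ ⊕ ι) 𝕜)) f) = 0 := by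
  classical
  rw [coeff_subst hasSubst_X_inl, finsum_eq_zero_of_forall_eq_zero]
  intro d
  rw [prod_X_inl_pow, coeff_monomial, if_neg, smul_zero]
  rintro rfl
  exact hR rfl

theorem pderiv_shift [DecidableEq σ] [DecidableEq ι] (p : ι → MvPowerSeries σ 𝕜) (b : ι)
    (y : σ ⊕ ι) :
    pderiv 𝕜 (Sum.inr b) (shift p y) = if y = Sum.inr b then 1 else 0 := by
  have h0 : ∀ f : MvPowerSeries σ 𝕜, pderiv 𝕜 (Sum.inr b)
      (subst (fun k => (X (Sum.inl k) : MvPowerSeries (σ ⊕ ι) 𝕜)) f) = 0 := by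
    intro f
    ext R
    rw [coeff_pderiv, coeff_subst_X_inl_eq_zero (b := b) f (by simp), zero_mul, map_zero]
  rcases y with k | c
  · simp [shift]
  · simp only [shift, Sum.elim_inr, map_add, h0, add_zero, pderiv_X, Pi.single_apply]

theorem radiusSum_shift_le {p : ι → MvPowerSeries σ 𝕜} (hp : ∀ b, constantCoeff (p b) = 0)
    {ρ K : ℝ≥0∞} (hρ : ρ ≤ 1) (hK : ∀ b, 1 + radiusSum 1 (p b) ≤ K) (hK1 : 1 ≤ K) (y : σ ⊕ ι) :
    radiusSum ρ (shift p y) ≤ ρ * K := by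
  refine (radiusSum_le_mul hρ (constantCoeff_shift hp y)).trans ?_
  gcongr
  rcases y with k | b
  · simpa [shift, radiusSum, weightedSum_X] using hK1
  · refine le_trans ?_ (hK b)
    simp only [shift, Sum.elim_inr]
    refine (weightedSum_add_le _ _ _).trans ?_
    gcongr
    · simp [weightedSum_X]
    · exact radiusSum_subst_le hasSubst_X_inl (fun k => by simp [radiusSum, weightedSum_X]) _

variable [Finite ι]

theorem hasSubst_shift {p : ι → MvPowerSeries σ 𝕜} (hp : ∀ b, constantCoeff (p b) = 0) :
    HasSubst (shift p) :=
  hasSubst_of_constantCoeff_zero (constantCoeff_shift hp)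

theorem hasSubst_sumElim_X {g : ι → MvPowerSeries σ 𝕜} (hg : ∀ b, constantCoeff (g b) = 0) :
    HasSubst (Sum.elim X g : σ ⊕ ι → MvPowerSeries σ 𝕜) := by
  refine hasSubst_of_constantCoeff_zero ?_
  rintro (k | b)
  · simp
  · exact hg b

theorem subst_translate {p g : ι → MvPowerSeries σ 𝕜} (hp : ∀ b, constantCoeff (p b) = 0)
    (hg : ∀ b, constantCoeff (g b) = 0) (W : MvPowerSeries (σ ⊕ ι) 𝕜) :
    subst (Sum.elim X g) (translate p W) =
      (subst (Sum.elim X (fun b => p b + g b)) W : MvPowerSeries σ 𝕜) := by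
  have hs := hasSubst_sumElim_X hg
  rw [translate, subst_comp_subst_apply (hasSubst_shift hp) hs]
  congr 1
  funext y
  rcases y with k | b
  · simp [shift, subst_X hs]
  · simp only [shift, Sum.elim_inr]
    rw [subst_add hs, subst_X hs, subst_comp_subst_apply hasSubst_X_inl hs, add_comm]
    simp_rw [subst_X hs, Sum.elim_inl, Sum.elim_inr]
    congr 1
    exact congrFun subst_self (p b)

/-- Setting `u = 0` kills exactly the monomials that contain some `u_b`. -/
theorem coeff_sumElim_zero (U : MvPowerSeries (σ ⊕ ι) 𝕜) (Q : σ →₀ ℕ) :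
    coeff (Finsupp.sumElim Q 0) U =
      coeff Q (subst (Sum.elim X 0 : σ ⊕ ι → MvPowerSeries σ 𝕜) U) := by
  classical
  have hs : HasSubst (Sum.elim X 0 : σ ⊕ ι → MvPowerSeries σ 𝕜) :=
    hasSubst_sumElim_X (by simp)
  rw [coeff_subst hs, finsum_eq_single _ (Finsupp.sumElim Q 0)]
  · rw [Finsupp.prod_sumElim, Finsupp.prod_zero_index, mul_one]
    simp [Function.comp_def, prod_X_pow]
  · intro d hd
    by_cases h : ∃ b, d (Sum.inr b) ≠ 0
    · obtain ⟨b, hb⟩ := h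
      rw [Finsupp.prod, Finset.prod_eq_zero (Finsupp.mem_support_iff.mpr hb), map_zero, smul_zero]
      simp [hb]
    · push Not at h
      obtain ⟨P, rfl⟩ : ∃ P, d = Finsupp.sumElim P 0 :=
        ⟨d.comapDomain Sum.inl Sum.inl_injective.injOn, by
          ext (k | b)
          · simp
          · simp [h b]⟩
      rw [Finsupp.prod_sumElim, Finsupp.prod_zero_index, mul_one]
      have hPQ : Q ≠ P := fun hPQ => hd (by rw [hPQ])
      simp [Function.comp_def, prod_X_pow, coeff_monomial, hPQ]

/-- Turns the regularity hypothesis, a statement on `∂W/∂u_b` along a jet, into one on the terms of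
the expansion that are linear in `u`. -/
theorem coeff_translate_single {p : ι → MvPowerSeries σ 𝕜} (hp : ∀ b, constantCoeff (p b) = 0)
    (W : MvPowerSeries (σ ⊕ ι) 𝕜) (Q : σ →₀ ℕ) (b : ι) :
    coeff (Finsupp.sumElim Q (Finsupp.single b 1)) (translate p W) =
      coeff Q (subst (Sum.elim X p : σ ⊕ ι → MvPowerSeries σ 𝕜) (pderiv 𝕜 (Sum.inr b) W)) := by
  classical
  have h1 := subst_translate (g := 0) hp (by simp) (pderiv 𝕜 (Sum.inr b) W)
  simp only [Pi.zero_apply, add_zero] at h1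
  rw [← h1, ← coeff_sumElim_zero, translate, translate,
    ← pderiv_subst_of_pderiv_eq_single (hasSubst_shift hp) (pderiv_shift p b) W, coeff_pderiv]
  have h2 : Finsupp.sumElim Q (Finsupp.single b 1) =
      Finsupp.sumElim Q 0 + Finsupp.single (Sum.inr b) 1 := by
    ext y
    rcases y with k | c <;> simp [Finsupp.single_apply]
  rw [h2]
  simp

theorem exists_radiusSum_translate_ne_top {p : ι → MvPowerSeries σ 𝕜}
    (hp : ∀ b, constantCoeff (p b) = 0) (hp' : ∀ b, radiusSum 1 (p b) ≠ ∞)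
    {W : MvPowerSeries (σ ⊕ ι) 𝕜} (hW : IsConvergent W) :
    ∃ ρ : ℝ≥0∞, ρ ≠ 0 ∧ radiusSum ρ (translate p W) ≠ ∞ := by
  have := Fintype.ofFinite ι
  obtain ⟨ρ₀, h0, h1⟩ := hW.exists_radiusSum_ne_top
  set K : ℝ≥0∞ := 1 + ∑ b, radiusSum 1 (p b) with hK
  have hK1 : 1 ≤ K := le_self_add
  have hKtop : K ≠ ∞ := ENNReal.add_ne_top.mpr
    ⟨ENNReal.one_ne_top, ENNReal.sum_ne_top.mpr fun b _ => hp' b⟩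
  refine ⟨min 1 (ρ₀ / K), ?_, ne_top_of_le_ne_top h1 ?_⟩
  · refine (lt_min one_pos (ENNReal.div_pos h0 hKtop)).ne'
  · refine radiusSum_subst_le (hasSubst_shift hp) (fun y => ?_) W
    refine (radiusSum_shift_le hp (min_le_left _ _) (fun b => ?_) hK1 y).trans ?_
    · rw [hK]
      gcongr
      exact Finset.single_le_sum (f := fun b => radiusSum 1 (p b)) (fun _ _ => zero_le)
        (Finset.mem_univ b)
    · calc _ ≤ ρ₀ / K * K := by gcongr; exact min_le_right _ _
        _ = ρ₀ := ENNReal.div_mul_cancel (by positivity) hKtop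

end Translate

/-! ### Weights on jet monomials -/

section JetWeight

open scoped ENNReal

variable {𝕜 : Type*} [RCLike 𝕜] {σ ι : Type*}

/-- The number of jet factors of the monomial `(x, u)^R`. -/
noncomputable def jetCount (R : σ ⊕ ι →₀ ℕ) : ℕ :=
  Finsupp.weight (Sum.elim 0 1 : σ ⊕ ι → ℕ) R

/-- The weight of the monomial `(x, u)^R`, where `x_k` has weight `1` and `u_b` has weight `w b`. -/
noncomputable def jetShift (w : ι → ℕ) (R : σ ⊕ ι →₀ ℕ) : ℕ :=
  Finsupp.weight (Sum.elim 1 w : σ ⊕ ι → ℕ) R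

theorem jetCount_add (R₁ R₂ : σ ⊕ ι →₀ ℕ) : jetCount (R₁ + R₂) = jetCount R₁ + jetCount R₂ :=
  map_add _ _ _

theorem jetShift_add (w : ι → ℕ) (R₁ R₂ : σ ⊕ ι →₀ ℕ) :
    jetShift w (R₁ + R₂) = jetShift w R₁ + jetShift w R₂ :=
  map_add _ _ _

theorem jetCount_sumElim (Q : σ →₀ ℕ) (γ : ι →₀ ℕ) :
    jetCount (Finsupp.sumElim Q γ) = γ.degree := by
  rw [jetCount, Finsupp.weight_apply, Finsupp.sum_sumElim]
  simp [Finsupp.sum, Finsupp.degree_apply]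

theorem jetShift_sumElim (w : ι → ℕ) (Q : σ →₀ ℕ) (γ : ι →₀ ℕ) :
    jetShift w (Finsupp.sumElim Q γ) = Q.degree + Finsupp.weight w γ := by
  rw [jetShift, Finsupp.weight_apply, Finsupp.sum_sumElim, Finsupp.weight_apply]
  simp [Finsupp.sum, Finsupp.degree_apply]

theorem degree_sumElim (Q : σ →₀ ℕ) (γ : ι →₀ ℕ) :
    (Finsupp.sumElim Q γ).degree = Q.degree + γ.degree := by
  rw [Finsupp.sumElim_eq_add, map_add, Finsupp.degree_mapDomain, Finsupp.degree_mapDomain]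

theorem exists_eq_sumElim (R : σ ⊕ ι →₀ ℕ) : ∃ Q γ, R = Finsupp.sumElim Q γ :=
  ⟨_, _, (Finsupp.comapDomain_sumElim_comapDomain R).symm⟩

/-- A positive submultiplicative sequence with ratio at most `t`. -/
structure IsDecaying (t : ℝ≥0∞) (h : ℕ → ℝ≥0∞) : Prop where
  zero_le_one : h 0 ≤ 1
  ne_zero : ∀ i, h i ≠ 0
  add_le_mul : ∀ i j, h (i + j) ≤ h i * h j
  add_le_pow_mul : ∀ i j, h (i + j) ≤ t ^ i * h j

open Classical in
/-- The weight by which the substitution of a jet into the monomial `(x, u)^R` is measured. -/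
noncomputable def jetWeight (h : ℕ → ℝ≥0∞) (L : ℕ) (w : ι → ℕ) (R : σ ⊕ ι →₀ ℕ)
    (Q : σ →₀ ℕ) : ℝ≥0∞ :=
  if jetShift w R + jetCount R * L ≤ Q.degree ∧ (jetCount R = 0 → Q.degree = jetShift w R) then
    h (Q.degree - jetShift w R - jetCount R * L) else ⊤

theorem IsDecaying.jetWeight_ne_zero {t : ℝ≥0∞} {h : ℕ → ℝ≥0∞} (hh : IsDecaying t h) (L : ℕ)
    (w : ι → ℕ) (R : σ ⊕ ι →₀ ℕ) (Q : σ →₀ ℕ) : jetWeight h L w R Q ≠ 0 := by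
  unfold jetWeight
  split_ifs
  · exact hh.ne_zero _
  · exact ENNReal.top_ne_zero

theorem IsDecaying.jetWeight_zero_le {t : ℝ≥0∞} {h : ℕ → ℝ≥0∞} (hh : IsDecaying t h) (L : ℕ)
    (w : ι → ℕ) : jetWeight h L w (0 : σ ⊕ ι →₀ ℕ) 0 ≤ 1 := by
  simpa [jetWeight, jetShift, jetCount] using hh.zero_le_one

/-- The value `⊤` off the admissible degrees makes the inequality trivial unless both factors are
admissible; then shifts, counts and degrees add, and `h` is submultiplicative. -/
theorem IsDecaying.jetWeight_add_le {t : ℝ≥0∞} {h : ℕ → ℝ≥0∞} (hh : IsDecaying t h) (L : ℕ)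
    (w : ι → ℕ) (R₁ R₂ : σ ⊕ ι →₀ ℕ) (P Q : σ →₀ ℕ) :
    jetWeight h L w (R₁ + R₂) (P + Q) ≤ jetWeight h L w R₁ P * jetWeight h L w R₂ Q := by
  by_cases h₁ : jetShift w R₁ + jetCount R₁ * L ≤ P.degree ∧
      (jetCount R₁ = 0 → P.degree = jetShift w R₁)
  swap
  · rw [jetWeight, jetWeight, if_neg h₁, ENNReal.top_mul (hh.jetWeight_ne_zero L w R₂ Q)]
    exact le_top
  by_cases h₂ : jetShift w R₂ + jetCount R₂ * L ≤ Q.degree ∧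
      (jetCount R₂ = 0 → Q.degree = jetShift w R₂)
  swap
  · rw [jetWeight.eq_1 h L w R₂, if_neg h₂, ENNReal.mul_top (hh.jetWeight_ne_zero L w R₁ P)]
    exact le_top
  simp only [jetWeight, if_pos h₁, if_pos h₂, jetShift_add, jetCount_add, map_add, add_mul]
  rw [if_pos]
  · refine le_trans (le_of_eq ?_) (hh.add_le_mul _ _)
    congr 1
    omega
  · refine ⟨by omega, fun h0 => ?_⟩
    rw [h₁.2 (by omega), h₂.2 (by omega)]

open Classical in
/-- The weight by which the components of the differential analytic map are measured. -/
noncomputable def imageWeight (h : ℕ → ℝ≥0∞) (q : ℕ) (Q : σ →₀ ℕ) : ℝ≥0∞ :=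
  if 2 * (q + 1) ≤ Q.degree then h (Q.degree - 2 * (q + 1)) else 0

/-- Here `p` is the number of jets in a monomial, `s` its shift, `e` its degree in `x` and `d` the
output degree. The loss `2(q + 1)` is covered by the jets if `p ≥ 2`, by the jet and `s ≥ q + 1` if
`p = 1`; if `p = 0`, then `d = s` and no index is left to account for. -/
theorem jet_exponent_arith {q e s d p : ℕ} (hs : e ≤ s) (hR : p = 1 → q + 1 ≤ s)
    (hc₁ : s + p * (q + 1) ≤ d) (hc₂ : p = 0 → d = s) (hQ : 2 * (q + 1) ≤ d) :
    p * (q + 1) + s - 2 * (q + 1) + (d - s - p * (q + 1)) = d - 2 * (q + 1) ∧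
      e + p ≤ p * (q + 1) + s - 2 * (q + 1) + 2 * (q + 1) := by
  match p with
  | 0 => have := hc₂ rfl; omega
  | 1 => have := hR rfl; omega
  | p' + 2 =>
    have : (p' + 2) * (q + 1) = 2 * (q + 1) + p' * q + p' := by ring
    omega

/-- Excess shift is converted into powers of `t`, enough to give one `t` to every variable of the
monomial at the fixed cost `t ^ (2 * (q + 1))`. -/
theorem IsDecaying.imageWeight_le {t : ℝ≥0∞} (ht0 : t ≠ 0) (ht : t ≤ 1) {h : ℕ → ℝ≥0∞}
    (hh : IsDecaying t h) (q : ℕ) (w : ι → ℕ) (R : σ ⊕ ι →₀ ℕ)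
    (hR : jetCount R = 1 → q + 1 ≤ jetShift w R) (Q : σ →₀ ℕ) :
    t ^ (2 * (q + 1)) * imageWeight h q Q ≤ t ^ R.degree * jetWeight h (q + 1) w R Q := by
  unfold imageWeight
  split_ifs with hQ
  swap
  · simp
  unfold jetWeight
  split_ifs with hcond
  swap
  · rw [ENNReal.mul_top (pow_ne_zero _ ht0)]
    exact le_top
  obtain ⟨hc₁, hc₂⟩ := hcond
  obtain ⟨P, γ, rfl⟩ := exists_eq_sumElim R
  rw [degree_sumElim]
  rw [jetCount_sumElim] at *
  have hs : P.degree ≤ jetShift w (Finsupp.sumElim P γ) := by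
    rw [jetShift_sumElim]; omega
  set s := jetShift w (Finsupp.sumElim P γ)
  set d := Q.degree
  set p := γ.degree
  have hp := jet_exponent_arith hs hR hc₁ hc₂ hQ
  calc t ^ (2 * (q + 1)) * h (d - 2 * (q + 1))
      ≤ t ^ (2 * (q + 1)) * (t ^ (p * (q + 1) + s - 2 * (q + 1)) * h (d - s - p * (q + 1))) := by
        gcongr
        rw [← hp.1]
        exact hh.add_le_pow_mul _ _
    _ = t ^ (p * (q + 1) + s - 2 * (q + 1) + 2 * (q + 1)) * h (d - s - p * (q + 1)) := by
        rw [pow_add]; ring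
    _ ≤ _ := by
        gcongr 1
        exact pow_le_pow_right_of_le_one' ht hp.2

end JetWeight

/-! ### Substitution of small jets into a series with controlled linear part -/

section CoreEstimate

open scoped ENNReal

variable {𝕜 : Type*} [RCLike 𝕜] {σ ι : Type*}

theorem mul_weightedSum (c : ℝ≥0∞) (ω : (σ →₀ ℕ) → ℝ≥0∞) (f : MvPowerSeries σ 𝕜) :
    c * weightedSum ω f = weightedSum (fun Q => c * ω Q) f := by
  rw [weightedSum, weightedSum, ← ENNReal.tsum_mul_left]
  exact tsum_congr fun Q => by ring

theorem jetCount_single_inl (k : σ) :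
    jetCount (Finsupp.single (Sum.inl k) 1 : σ ⊕ ι →₀ ℕ) = 0 := by
  simp [jetCount, Finsupp.weight_single]

theorem jetCount_single_inr (b : ι) :
    jetCount (Finsupp.single (Sum.inr b) 1 : σ ⊕ ι →₀ ℕ) = 1 := by
  simp [jetCount, Finsupp.weight_single]

theorem jetShift_single_inl (w : ι → ℕ) (k : σ) :
    jetShift w (Finsupp.single (Sum.inl k) 1) = 1 := by
  simp [jetShift, Finsupp.weight_single]

theorem jetShift_single_inr (w : ι → ℕ) (b : ι) :
    jetShift w (Finsupp.single (Sum.inr b) 1 : σ ⊕ ι →₀ ℕ) = w b := by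
  simp [jetShift, Finsupp.weight_single]

/-- Every substituted variable has norm at most `K` and brings a factor `t`, so the expansion is
dominated by the norm of `V` at radius `t * K`, whatever the sequence `h`. -/
theorem mul_weightedSum_subst_le [Finite σ] [Finite ι] {t K : ℝ≥0∞} (ht0 : t ≠ 0) (ht : t ≤ 1)
    (hK : 1 ≤ K) {h : ℕ → ℝ≥0∞} (hh : IsDecaying t h) {q : ℕ} {w : ι → ℕ}
    {V : MvPowerSeries (σ ⊕ ι) 𝕜}
    (hV : ∀ R, coeff R V ≠ 0 → jetCount R = 1 → q + 1 ≤ jetShift w R)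
    {g : ι → MvPowerSeries σ 𝕜} (hg0 : ∀ b, constantCoeff (g b) = 0)
    (hg : ∀ b, weightedSum (jetWeight h (q + 1) w (Finsupp.single (Sum.inr b) 1)) (g b) ≤ K) :
    t ^ (2 * (q + 1)) * weightedSum (imageWeight h q) (subst (Sum.elim X g) V) ≤
      radiusSum (t * K) V := by
  have hy : ∀ y : σ ⊕ ι, weightedSum (jetWeight h (q + 1) w (Finsupp.single y 1))
      ((Sum.elim X g : σ ⊕ ι → MvPowerSeries σ 𝕜) y) ≤ K := by
    rintro (k | b)
    · rw [Sum.elim_inl, weightedSum_X, jetWeight, jetCount_single_inl, jetShift_single_inl,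
        Finsupp.degree_single]
      simpa using hh.zero_le_one.trans hK
    · exact hg b
  rw [mul_weightedSum]
  refine (weightedSum_subst_le _ (hasSubst_sumElim_X hg0) V).trans
    (ENNReal.tsum_le_tsum fun R => ?_)
  by_cases hR : coeff R V = 0
  · simp [hR]
  gcongr
  beta_reduce
  refine (weightedSum_le_mul _ fun Q _ => hh.imageWeight_le ht0 ht q w R (hV R hR) Q).trans ?_
  rw [mul_pow]
  gcongr
  refine (weightedSum_prod_le (hh.jetWeight_zero_le _ w) (hh.jetWeight_add_le _ w) _ R).trans ?_
  rw [Finsupp.degree_apply, ← Finset.prod_pow_eq_pow_sum]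
  exact Finset.prod_le_prod' fun y _ => pow_le_pow_left' (hy y) _

theorem IsDecaying.mono {t t' : ℝ≥0∞} {h : ℕ → ℝ≥0∞} (hh : IsDecaying t h) (ht : t ≤ t') :
    IsDecaying t' h :=
  ⟨hh.1, hh.2, hh.3, fun i j => (hh.4 i j).trans (by gcongr)⟩

end CoreEstimate

/-! ### Estimates for jets and for the differential map -/

section Jets

open scoped ENNReal

variable {𝕜 : Type*} [RCLike 𝕜] {n r m : ℕ}

/-- The weight by which the components of the unknowns are measured. -/
noncomputable def sourceWeight (h : ℕ → ℝ≥0∞) (m L : ℕ) (Q : Fin n →₀ ℕ) : ℝ≥0∞ :=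
  ((Q.degree - m : ℕ) : ℝ≥0∞) ^ m * h (Q.degree - m - L)

theorem coeff_partialDeriv (a Q : Fin n →₀ ℕ) (f : FSeries 𝕜 n) :
    coeff Q (partialDeriv a f) =
      ((∏ k, (Q k + a k).descFactorial (a k) : ℕ) : 𝕜) * coeff (Q + a) f :=
  rfl

theorem partialDeriv_add (a : Fin n →₀ ℕ) (f g : FSeries 𝕜 n) :
    partialDeriv a (f + g) = partialDeriv a f + partialDeriv a g := by
  ext Q
  rw [map_add, coeff_partialDeriv, coeff_partialDeriv, coeff_partialDeriv, map_add, mul_add]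

theorem constantCoeff_partialDeriv (F : Unknown 𝕜 n r m) (j : Fin r) {a : Fin n →₀ ℕ}
    (ha : a.degree ≤ m) : constantCoeff (partialDeriv a (F.1 j)) = 0 := by
  rw [← coeff_zero_eq_constantCoeff_apply, coeff_partialDeriv, coeff_of_lt_order, mul_zero]
  refine lt_of_le_of_lt ?_ (F.2 j)
  simpa using ha

theorem prod_descFactorial_le (a Q : Fin n →₀ ℕ) :
    ∏ k, (Q k + a k).descFactorial (a k) ≤ (Q + a).degree ^ a.degree := by
  rw [Finsupp.degree_eq_sum a, ← Finset.prod_pow_eq_pow_sum]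
  refine Finset.prod_le_prod' fun k _ => (Nat.descFactorial_le_pow _ _).trans ?_
  gcongr
  exact Finsupp.le_degree k (Q + a)

/-- At degree `d > m` of `f` the derivative costs at most `d ^ m ≤ (m + 1) ^ m * (d - m) ^ m`, which
the source weight contains. The shift `m - |a|` of the jet variable compensates for the drop in
degree. -/
theorem weightedSum_partialDeriv_le {h : ℕ → ℝ≥0∞} {L : ℕ} {f : FSeries 𝕜 n}
    (hf : ((m + L : ℕ) : ℕ∞) < f.order) (j : Fin r)
    (a : {a : Fin n →₀ ℕ // a.degree ≤ m}) :
    weightedSum (jetWeight h L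
      (fun b : Fin r × {a : Fin n →₀ ℕ // a.degree ≤ m} => m - b.2.1.degree)
      (Finsupp.single (Sum.inr (j, a)) 1)) (partialDeriv a.1 f) ≤
      ((m + 1 : ℕ) : ℝ≥0∞) ^ m * weightedSum (sourceWeight h m L) f := by
  have ha := a.2
  have key : ∀ Q : Fin n →₀ ℕ, ‖coeff Q (partialDeriv a.1 f)‖ₑ * jetWeight h L
      (fun b : Fin r × {a : Fin n →₀ ℕ // a.degree ≤ m} => m - b.2.1.degree)
      (Finsupp.single (Sum.inr (j, a)) 1) Q ≤ (fun Q' => ((m + 1 : ℕ) : ℝ≥0∞) ^ m *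
        (‖coeff Q' f‖ₑ * sourceWeight h m L Q')) (Q + a.1) := by
    intro Q
    beta_reduce
    rw [coeff_partialDeriv]
    by_cases hQ : coeff (Q + a.1) f = 0
    · simp [hQ]
    have hdeg : m + L < (Q + a.1).degree := by
      have := hf.trans_le (order_le hQ)
      exact_mod_cast this
    rw [map_add] at hdeg
    rw [jetWeight, jetCount_single_inr, jetShift_single_inr, if_pos ⟨by dsimp only; omega, by simp⟩,
      enorm_mul, sourceWeight, map_add]
    have h1 : ‖((∏ k, (Q k + a.1 k).descFactorial (a.1 k) : ℕ) : 𝕜)‖ₑ ≤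
        ((m + 1 : ℕ) : ℝ≥0∞) ^ m * ((Q.degree + a.1.degree - m : ℕ) : ℝ≥0∞) ^ m := by
      rw [← ofReal_norm, RCLike.norm_natCast, ENNReal.ofReal_natCast]
      norm_cast
      refine (prod_descFactorial_le a.1 Q).trans ?_
      rw [map_add, ← mul_pow]
      calc (Q.degree + a.1.degree) ^ a.1.degree ≤ (Q.degree + a.1.degree) ^ m :=
            Nat.pow_le_pow_right (by omega) ha
        _ ≤ _ := by
            gcongr
            obtain ⟨c, hc⟩ := Nat.exists_eq_add_of_lt (lt_of_le_of_lt (Nat.le_add_right m L) hdeg)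
            rw [hc, show m + c + 1 - m = c + 1 by omega]
            nlinarith [Nat.zero_le (m * c)]
    have h2 : Q.degree - (m - a.1.degree) - 1 * L = Q.degree + a.1.degree - m - L := by omega
    rw [h2]
    calc _ ≤ (((m + 1 : ℕ) : ℝ≥0∞) ^ m * ((Q.degree + a.1.degree - m : ℕ) : ℝ≥0∞) ^ m) *
          ‖coeff (Q + a.1) f‖ₑ * h (Q.degree + a.1.degree - m - L) := by gcongr
      _ = _ := by ring
  rw [weightedSum, weightedSum, ← ENNReal.tsum_mul_left]
  exact (ENNReal.tsum_le_tsum key).trans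
    (ENNReal.tsum_comp_le_tsum_of_injective (add_left_injective a.1) _)

theorem jet_eq_sumElim (F : FTuple 𝕜 n r) : jet m F = Sum.elim X
    (fun b : Fin r × {a : Fin n →₀ ℕ // a.degree ≤ m} => partialDeriv b.2.1 (F b.1)) := by
  funext y
  rcases y with k | ⟨j, a⟩ <;> rfl

theorem radiusSum_one_ne_top {f : FSeries 𝕜 n} {N : ℕ} (hf : ∀ Q, N < Q.degree → coeff Q f = 0) :
    radiusSum 1 f ≠ ∞ := by
  have hfin : {Q : Fin n →₀ ℕ | Q.degree ≤ N}.Finite := Finsupp.finite_of_degree_le N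
  rw [radiusSum, weightedSum, tsum_eq_sum (s := hfin.toFinset)]
  · exact ENNReal.sum_ne_top.mpr fun Q _ => by simp
  · intro Q hQ
    rw [hf Q (by simpa using hQ)]
    simp

/-- The order of quantifiers matters: `t` and `A` depend only on `W`, `P` and the fixed orders, not
on `h`, so the ratio of `h` can be shrunk afterwards without spoiling the bound. -/
theorem exists_weightedSum_compJet_le {q : ℕ} {W : MvPowerSeries (JetVar n r m) 𝕜}
    (hW : IsConvergent W) (P : Unknown 𝕜 n r m) {N : ℕ}
    (hP : ∀ j Q, N < Q.degree → coeff Q (P.1 j) = 0)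
    (hord : ∀ (j : Fin r) (a : {a : Fin n →₀ ℕ // a.degree ≤ m}),
      ((a.1.degree + q + 1 - m : ℕ) : ℕ∞) ≤
        (compJet (pderiv 𝕜 (Sum.inr (j, a)) W) P.1).order) :
    ∃ t : ℝ≥0∞, t ≠ 0 ∧ t ≤ 1 ∧ ∃ A : ℝ≥0∞, A ≠ ∞ ∧ ∀ h, IsDecaying t h →
      ∀ G ∈ filt 𝕜 n r m (q + 1), (∀ j, weightedSum (sourceWeight h m (q + 1)) (G j) ≤ 1) →
        weightedSum (imageWeight h q) (compJet W (P.1 + G)) ≤ A := by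
  have hfin : Finite {a : Fin n →₀ ℕ // a.degree ≤ m} := Finsupp.finite_of_degree_le m
  set p : Fin r × {a : Fin n →₀ ℕ // a.degree ≤ m} → FSeries 𝕜 n :=
    fun b => partialDeriv b.2.1 (P.1 b.1) with hp_def
  have hp : ∀ b, constantCoeff (p b) = 0 := fun b => constantCoeff_partialDeriv P b.1 b.2.2
  have hp' : ∀ b, radiusSum 1 (p b) ≠ ∞ := fun b => radiusSum_one_ne_top (N := N) fun Q hQ => by
    rw [hp_def, coeff_partialDeriv, hP, mul_zero]
    rw [map_add]
    omega
  obtain ⟨ρ, hρ0, hρ⟩ := exists_radiusSum_translate_ne_top hp hp' hW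
  set V := translate p W with hV_def
  set K : ℝ≥0∞ := ((m + 1 : ℕ) : ℝ≥0∞) ^ m with hK_def
  have hK : 1 ≤ K := by
    rw [hK_def]
    exact one_le_pow₀ (by exact_mod_cast Nat.le_add_left 1 m)
  have hKtop : K ≠ ∞ := ENNReal.pow_ne_top (ENNReal.natCast_ne_top _)
  -- `K` bounds the jets of `G`; after scaling by `t` they lie within the radius `ρ` at which `V`
  -- has finite norm.
  set t := min 1 (ρ / K) with ht_def
  have ht0 : t ≠ 0 := (lt_min one_pos (ENNReal.div_pos hρ0 hKtop)).ne'
  have ht1 : t ≤ 1 := min_le_left _ _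
  have htK : t * K ≤ ρ := by
    calc t * K ≤ ρ / K * K := by gcongr; exact min_le_right _ _
      _ = ρ := ENNReal.div_mul_cancel (by positivity) hKtop
  -- The coefficient of `u_{j,a}` has order at least `|a| + q + 1 - m`; adding the shift `m - |a|`
  -- gives `q + 1`, also when the subtraction truncates.
  have hVlin : ∀ R, coeff R V ≠ 0 → jetCount R = 1 →
      q + 1 ≤ jetShift (fun b : Fin r × {a : Fin n →₀ ℕ // a.degree ≤ m} => m - b.2.1.degree) R := by
    intro R hR h1
    obtain ⟨Q, γ, rfl⟩ := exists_eq_sumElim R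
    rw [jetCount_sumElim] at h1
    obtain ⟨⟨j, a⟩, rfl⟩ : γ ∈ Set.range fun b => Finsupp.single b 1 := by
      rwa [Finsupp.range_single_one]
    rw [hV_def, coeff_translate_single hp] at hR
    have h2 := hord j a
    rw [compJet, jet_eq_sumElim] at h2
    have h3 := h2.trans (order_le hR)
    have h4 : a.1.degree + q + 1 - m ≤ Q.degree := by exact_mod_cast h3
    rw [jetShift_sumElim, Finsupp.weight_single]
    simp only [one_smul]
    have := a.2
    omega
  refine ⟨t, ht0, ht1, radiusSum (t * K) V / t ^ (2 * (q + 1)), ?_, ?_⟩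
  · refine ENNReal.div_ne_top (ne_top_of_le_ne_top hρ ?_) (pow_ne_zero _ ht0)
    exact ENNReal.tsum_le_tsum fun Q => by beta_reduce; gcongr
  · intro h hh G hG hG1
    have hG0 : G ∈ filt 𝕜 n r m 0 := fun j =>
      lt_of_le_of_lt (by exact_mod_cast Nat.le_add_right m (q + 1)) (hG j)
    rw [ENNReal.le_div_iff_mul_le (Or.inl (pow_ne_zero _ ht0))
      (Or.inl (ENNReal.pow_ne_top (ne_top_of_le_ne_top ENNReal.one_ne_top ht1))), mul_comm]
    have hg0 : ∀ b : Fin r × {a : Fin n →₀ ℕ // a.degree ≤ m},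
        constantCoeff (partialDeriv b.2.1 (G b.1)) = 0 :=
      fun b => constantCoeff_partialDeriv ⟨G, hG0⟩ b.1 b.2.2
    have hsub : compJet W (P.1 + G) = subst (Sum.elim X
        (fun b : Fin r × {a : Fin n →₀ ℕ // a.degree ≤ m} => partialDeriv b.2.1 (G b.1))) V := by
      rw [hV_def, subst_translate hp hg0, compJet, jet_eq_sumElim]
      simp_rw [hp_def, Pi.add_apply, partialDeriv_add]
    rw [hsub]
    refine mul_weightedSum_subst_le ht0 ht1 hK hh hVlin hg0 fun b => ?_
    refine (weightedSum_partialDeriv_le (hG b.1) b.1 b.2).trans ?_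
    calc _ ≤ K * 1 := by gcongr; exact hG1 b.1
      _ = K := mul_one K

end Jets

/-! ### Degreewise right inverse and formal fixed point -/

section Formal

variable {𝕜 : Type*} [RCLike 𝕜] {n r s m : ℕ}

theorem natCast_lt_order_iff {σ : Type*} {f : MvPowerSeries σ 𝕜} {k : ℕ} :
    (k : ℕ∞) < f.order ↔ ∀ Q : σ →₀ ℕ, Q.degree ≤ k → coeff Q f = 0 := by
  constructor
  · intro h Q hQ
    exact coeff_of_lt_order (lt_of_le_of_lt (by exact_mod_cast hQ) h)
  · intro h
    have h1 : ((k + 1 : ℕ) : ℕ∞) ≤ f.order := nat_le_order fun Q hQ => h Q (by omega)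
    exact lt_of_lt_of_le (by exact_mod_cast Nat.lt_succ_self k) h1

theorem mem_filt_iff {F : FTuple 𝕜 n r} {i : ℕ} :
    F ∈ filt 𝕜 n r m i ↔ ∀ j Q, Q.degree ≤ m + i → coeff Q (F j) = 0 :=
  forall_congr' fun _ => natCast_lt_order_iff

theorem filt_anti {i k : ℕ} (h : i ≤ k) : filt 𝕜 n r m k ≤ filt 𝕜 n r m i := by
  intro F hF
  rw [mem_filt_iff] at hF ⊢
  exact fun j Q hQ => hF j Q (by omega)

theorem mem_finsuppAntidiag_univ {i : ℕ} {Q : Fin n →₀ ℕ} :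
    Q ∈ Finset.finsuppAntidiag (Finset.univ : Finset (Fin n)) i ↔ Q.degree = i := by
  rw [Finset.mem_finsuppAntidiag, Finsupp.degree_eq_sum]
  simp

theorem homNorm_nonneg (i : ℕ) (f : FSeries 𝕜 n) : 0 ≤ homNorm i f :=
  Finset.sum_nonneg fun _ _ => norm_nonneg _

theorem homNorm_congr {i : ℕ} {f g : FSeries 𝕜 n}
    (h : ∀ Q : Fin n →₀ ℕ, Q.degree = i → coeff Q f = coeff Q g) : homNorm i f = homNorm i g :=
  Finset.sum_congr rfl fun Q hQ => by rw [h Q (mem_finsuppAntidiag_univ.mp hQ)]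

theorem tupleHomNorm_congr {k i : ℕ} {F G : FTuple 𝕜 n k}
    (h : ∀ l (Q : Fin n →₀ ℕ), Q.degree = i → coeff Q (F l) = coeff Q (G l)) :
    tupleHomNorm i F = tupleHomNorm i G :=
  iSup_congr fun l => homNorm_congr (h l)

theorem tupleHomNorm_zero {k i : ℕ} : tupleHomNorm i (0 : FTuple 𝕜 n k) = 0 := by
  simp [tupleHomNorm, homNorm]

theorem tupleHomNorm_le_sum {k : ℕ} (i : ℕ) (G : FTuple 𝕜 n k) :
    tupleHomNorm i G ≤ ∑ l, homNorm i (G l) :=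
  Real.iSup_le (fun l => Finset.single_le_sum (f := fun l => homNorm i (G l))
    (fun l _ => homNorm_nonneg i (G l)) (Finset.mem_univ l))
    (Finset.sum_nonneg fun l _ => homNorm_nonneg i (G l))

theorem coeff_eq_zero_of_homNorm_le_zero {f : FSeries 𝕜 n} {Q : Fin n →₀ ℕ}
    (h : homNorm Q.degree f ≤ 0) : coeff Q f = 0 := by
  have h0 := h.antisymm (homNorm_nonneg _ f)
  exact norm_eq_zero.mp ((Finset.sum_eq_zero_iff_of_nonneg fun _ _ => norm_nonneg _).mp h0 Q
    (mem_finsuppAntidiag_univ.mpr rfl))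

/-- A map `B` on right-hand sides satisfies the big denominators estimate. -/
def SolvesWithBound (q : ℕ) (C β : ℝ) (B : FTuple 𝕜 n s → Unknown 𝕜 n r m) : Prop :=
  ∀ G : FTuple 𝕜 n s, (∀ l, (q : ℕ∞) < (G l).order) → ∀ (j : Fin r) (i : ℕ), 1 ≤ i →
    homNorm (i + m) ((B G).1 j) ≤ C * tupleHomNorm (i + q) G / (i : ℝ) ^ β

theorem SolvesWithBound.coeff_eq_zero {q : ℕ} {C β : ℝ} {B : FTuple 𝕜 n s → Unknown 𝕜 n r m}
    (hB : SolvesWithBound q C β B) {G : FTuple 𝕜 n s} (hG : ∀ l, (q : ℕ∞) < (G l).order)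
    {Q : Fin n →₀ ℕ} (hQ : ∀ l (Q' : Fin n →₀ ℕ), m < Q.degree → Q'.degree + m = Q.degree + q →
      coeff Q' (G l) = 0) (j : Fin r) : coeff Q ((B G).1 j) = 0 := by
  rcases Nat.lt_or_ge m Q.degree with hm | hm
  · obtain ⟨i, hi⟩ := Nat.exists_eq_add_of_lt hm
    have h := hB G hG j (i + 1) (by omega)
    have h0 : tupleHomNorm (i + 1 + q) G = 0 := by
      rw [← tupleHomNorm_zero (𝕜 := 𝕜) (n := n) (k := s)]
      exact tupleHomNorm_congr fun l Q' hQ' => hQ l Q' hm (by omega)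
    rw [h0, mul_zero, zero_div, show i + 1 + m = Q.degree by omega] at h
    exact coeff_eq_zero_of_homNorm_le_zero h
  · exact mem_filt_iff.mp (B G).2 j Q (by omega)

/-- The homogeneous part of degree `d` of a tuple. -/
noncomputable def homPart (d : ℕ) (G : FTuple 𝕜 n s) : FTuple 𝕜 n s :=
  fun l => homogeneousComponent d (G l)

theorem coeff_homPart (d : ℕ) (G : FTuple 𝕜 n s) (l : Fin s) (Q : Fin n →₀ ℕ) :
    coeff Q (homPart d G l) = if Q.degree = d then coeff Q (G l) else 0 :=
  coeff_homogeneousComponent d Q (G l)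

theorem lt_order_homPart {q i : ℕ} (hi : 1 ≤ i) (G : FTuple 𝕜 n s) (l : Fin s) :
    (q : ℕ∞) < (homPart (i + q) G l).order :=
  natCast_lt_order_iff.mpr fun Q hQ => by rw [coeff_homPart, if_neg (by omega)]

/-- The map obtained from `B` by solving separately for each homogeneous part. -/
noncomputable def degreewise (q : ℕ) (B : FTuple 𝕜 n s → Unknown 𝕜 n r m) (G : FTuple 𝕜 n s) :
    Unknown 𝕜 n r m :=
  ⟨fun j Q => if Q.degree ≤ m then 0 else coeff Q ((B (homPart (Q.degree - m + q) G)).1 j),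
    mem_filt_iff.mpr fun _ _ hQ => if_pos hQ⟩

theorem coeff_degreewise (q : ℕ) (B : FTuple 𝕜 n s → Unknown 𝕜 n r m) (G : FTuple 𝕜 n s)
    {Q : Fin n →₀ ℕ} {i : ℕ} (hi : 1 ≤ i) (hQ : Q.degree = i + m) (j : Fin r) :
    coeff Q ((degreewise q B G).1 j) = coeff Q ((B (homPart (i + q) G)).1 j) := by
  have h : Q.degree - m = i := by omega
  refine (if_neg (by omega)).trans ?_
  rw [h]

theorem SolvesWithBound.degreewise {q : ℕ} {C β : ℝ} {B : FTuple 𝕜 n s → Unknown 𝕜 n r m}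
    (hB : SolvesWithBound q C β B) : SolvesWithBound q C β (degreewise q B) := by
  intro G _ j i hi
  rw [homNorm_congr (g := (B (homPart (i + q) G)).1 j) fun Q hQ =>
    coeff_degreewise q B G hi hQ j]
  refine (hB _ (lt_order_homPart hi G) j i hi).trans (le_of_eq ?_)
  rw [tupleHomNorm_congr fun l Q hQ => (coeff_homPart (i + q) G l Q).trans (if_pos hQ)]

/-- Locality stands in for linearity: right-hand sides that agree up to degree `k + q` have
solutions that agree up to degree `m + k`. -/
theorem degreewise_sub_mem (q : ℕ) (B : FTuple 𝕜 n s → Unknown 𝕜 n r m) {G G' : FTuple 𝕜 n s}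
    {k : ℕ} (h : ∀ l (Q : Fin n →₀ ℕ), Q.degree ≤ k + q → coeff Q (G l) = coeff Q (G' l)) :
    (degreewise q B G).1 - (degreewise q B G').1 ∈ filt 𝕜 n r m k := by
  refine mem_filt_iff.mpr fun j Q hQ => ?_
  rw [Pi.sub_apply, map_sub, sub_eq_zero]
  rcases Nat.lt_or_ge m Q.degree with hm | hm
  · obtain ⟨i, hi⟩ := Nat.exists_eq_add_of_lt hm
    have hi' : Q.degree = (i + 1) + m := by omega
    rw [coeff_degreewise q B G (by omega) hi', coeff_degreewise q B G' (by omega) hi']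
    have : homPart (i + 1 + q) G = homPart (i + 1 + q) G' := by
      funext l
      ext Q'
      rw [coeff_homPart, coeff_homPart]
      split_ifs with hQ'
      · exact h l Q' (by omega)
      · rfl
    rw [this]
  · rw [mem_filt_iff.mp (degreewise q B G).2 j Q (by omega),
      mem_filt_iff.mp (degreewise q B G').2 j Q (by omega)]

/-- The map `π` is only linear and cannot be applied term by term to an infinite sum. For a given
degree `k`, finitely many homogeneous parts suffice: the tail `G - A` has order above `q + k`, so `B
(G - A)` lies deep in the filtration, and `π (G - A) = S (B (G - A))` vanishes up to degree `k`. -/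
theorem map_degreewise {q : ℕ} {C β : ℝ} {B : FTuple 𝕜 n s → Unknown 𝕜 n r m}
    (hB : SolvesWithBound q C β B) {S : Unknown 𝕜 n r m →ₗ[𝕜] FTuple 𝕜 n s}
    (hS : IncreasesOrder q S) {π : FTuple 𝕜 n s →ₗ[𝕜] FTuple 𝕜 n s} (hSB : ∀ G, S (B G) = π G)
    {G : FTuple 𝕜 n s} (hG : ∀ l, (q : ℕ∞) < (G l).order) : S (degreewise q B G) = π G := by
  have hdiff : ∀ (F F' : Unknown 𝕜 n r m) (k : ℕ), F.1 - F'.1 ∈ filt 𝕜 n r m k →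
      ∀ l (Q : Fin n →₀ ℕ), Q.degree ≤ k → coeff Q (S F l) = coeff Q (S F' l) := by
    intro F F' k h l Q hQ
    rw [← sub_eq_zero, ← map_sub]
    refine coeff_of_lt_order (lt_of_lt_of_le ?_ (hS F F' k h l))
    exact_mod_cast (by omega : Q.degree < k + 1 + q)
  funext l
  ext Q
  set k := Q.degree with hk
  set A : FTuple 𝕜 n s := ∑ i ∈ Finset.Icc 1 k, homPart (i + q) G with hA
  have hAS : S (∑ i ∈ Finset.Icc 1 k, B (homPart (i + q) G)) = π A := by
    rw [hA, map_sum, map_sum]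
    exact Finset.sum_congr rfl fun i _ => hSB _
  have htail : ∀ l, ((q + k : ℕ) : ℕ∞) < ((G - A) l).order := by
    intro l
    refine natCast_lt_order_iff.mpr fun Q' hQ' => ?_
    rw [Pi.sub_apply, map_sub, sub_eq_zero, hA, Finset.sum_apply, map_sum]
    simp_rw [coeff_homPart]
    rcases Nat.lt_or_ge q Q'.degree with hm | hm
    · rw [Finset.sum_eq_single (Q'.degree - q), if_pos (by omega)]
      · intro i _ hi
        exact if_neg (by omega)
      · intro hi
        rw [Finset.mem_Icc] at hi
        omega
    · rw [natCast_lt_order_iff.mp (hG l) Q' hm]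
      refine (Finset.sum_eq_zero fun i hi => ?_).symm
      rw [Finset.mem_Icc] at hi
      exact if_neg (by omega)
  have htail' : ∀ l, (q : ℕ∞) < ((G - A) l).order := fun l =>
    lt_of_le_of_lt (by exact_mod_cast Nat.le_add_right q k) (htail l)
  have h1 : coeff Q (S (degreewise q B G) l) = coeff Q (π A l) := by
    rw [← hAS]
    refine hdiff _ _ k (mem_filt_iff.mpr fun j Q' hQ' => ?_) l Q le_rfl
    rw [Pi.sub_apply, map_sub, sub_eq_zero]
    have hcoe : (∑ i ∈ Finset.Icc 1 k, B (homPart (i + q) G)).1 j =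
        ∑ i ∈ Finset.Icc 1 k, (B (homPart (i + q) G)).1 j := by
      rw [Submodule.coe_sum, Finset.sum_apply]
    rcases Nat.lt_or_ge m Q'.degree with hm | hm
    · obtain ⟨i, hi⟩ := Nat.exists_eq_add_of_lt hm
      rw [coeff_degreewise q B G (i := i + 1) (by omega) (by omega), hcoe, map_sum,
        Finset.sum_eq_single (i + 1)]
      -- By the estimate, a homogeneous right-hand side gives a solution concentrated in one degree,
      -- so the other summands do not interfere.
      · intro i' hi' hne
        rw [Finset.mem_Icc] at hi'
        refine hB.coeff_eq_zero (lt_order_homPart hi'.1 G) (fun l Q'' _ hQ'' => ?_) j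
        rw [coeff_homPart, if_neg (by omega)]
      · intro hi'
        rw [Finset.mem_Icc] at hi'
        omega
    · rw [mem_filt_iff.mp (degreewise q B G).2 j Q' (by omega),
        mem_filt_iff.mp (∑ i ∈ Finset.Icc 1 k, B (homPart (i + q) G)).2 j Q' (by omega)]
  have h2 : coeff Q (π (G - A) l) = 0 := by
    rw [← hSB, hdiff (B (G - A)) 0 k _ l Q le_rfl, map_zero, Pi.zero_apply, map_zero]
    rw [Submodule.coe_zero, sub_zero]
    refine mem_filt_iff.mpr fun j Q' hQ' => hB.coeff_eq_zero htail' (fun l Q'' hm hQ'' => ?_) j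
    exact natCast_lt_order_iff.mp (htail l) Q'' (by omega)
  rw [h1, ← sub_eq_zero, ← neg_sub, ← map_sub, ← Pi.sub_apply, ← map_sub, h2, neg_zero]

theorem exists_fixedPoint {Ψ : Unknown 𝕜 n r m → Unknown 𝕜 n r m}
    (hΨ : ∀ (F G : Unknown 𝕜 n r m) (k : ℕ), F.1 - G.1 ∈ filt 𝕜 n r m k →
      (Ψ F).1 - (Ψ G).1 ∈ filt 𝕜 n r m (k + 1)) : ∃ F, Ψ F = F := by
  set u : ℕ → Unknown 𝕜 n r m := fun k => Ψ^[k] 0 with hu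
  have hsucc : ∀ k, u (k + 1) = Ψ (u k) := fun k => Function.iterate_succ_apply' Ψ k 0
  have hstep : ∀ k, (u (k + 1)).1 - (u k).1 ∈ filt 𝕜 n r m k := by
    intro k
    induction k with
    | zero => exact sub_mem (u 1).2 (u 0).2
    | succ k ih =>
      rw [hsucc (k + 1), hsucc k]
      refine hΨ _ _ k ?_
      rwa [← hsucc k]
  have hlong : ∀ k d, (u (k + d)).1 - (u k).1 ∈ filt 𝕜 n r m k := by
    intro k d
    induction d with
    | zero => simp
    | succ d ih =>
      have h := add_mem (filt_anti (Nat.le_add_right k d) (hstep (k + d))) ih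
      rwa [sub_add_sub_cancel] at h
  have hcoeff : ∀ k d j (Q : Fin n →₀ ℕ), Q.degree ≤ m + k →
      coeff Q ((u (k + d)).1 j) = coeff Q ((u k).1 j) := by
    intro k d j Q hQ
    have := mem_filt_iff.mp (hlong k d) j Q hQ
    rwa [Pi.sub_apply, map_sub, sub_eq_zero] at this
  -- Coefficients of degree `d` no longer change from the iterate `u d` on, so the limit is read off
  -- diagonally.
  set F : FTuple 𝕜 n r := fun j Q => coeff Q ((u Q.degree).1 j) with hF
  have hFc : ∀ j Q, coeff Q (F j) = coeff Q ((u Q.degree).1 j) := fun _ _ => rfl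
  have hF0 : F ∈ filt 𝕜 n r m 0 := mem_filt_iff.mpr fun j Q hQ => by
    rw [hFc]
    exact mem_filt_iff.mp (u Q.degree).2 j Q hQ
  have hFu : ∀ k, F - (u k).1 ∈ filt 𝕜 n r m k := by
    refine fun k => mem_filt_iff.mpr fun j Q hQ => ?_
    rw [Pi.sub_apply, map_sub, sub_eq_zero, hFc]
    rcases le_total k Q.degree with h | h
    · obtain ⟨d, hd⟩ := Nat.exists_eq_add_of_le h
      rw [hd]
      exact hcoeff k d j Q hQ
    · obtain ⟨d, hd⟩ := Nat.exists_eq_add_of_le h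
      rw [hd]
      exact (hcoeff Q.degree d j Q (by omega)).symm
  refine ⟨⟨F, hF0⟩, Subtype.ext ?_⟩
  have hfix : ∀ k, (Ψ ⟨F, hF0⟩).1 - F ∈ filt 𝕜 n r m k := by
    intro k
    have h1 := filt_anti (Nat.le_succ k) (hΨ ⟨F, hF0⟩ (u k) k (hFu k))
    have h2 := filt_anti (Nat.le_succ k) (hFu (k + 1))
    rw [hsucc] at h2
    have h3 := sub_mem h1 h2
    rwa [sub_sub_sub_cancel_right] at h3
  funext j
  ext Q
  have := mem_filt_iff.mp (hfix Q.degree) j Q (by omega)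
  rwa [Pi.sub_apply, map_sub, sub_eq_zero] at this

end Formal

/-! ### Gevrey weights and the bootstrap on truncations -/

section Gevrey

open scoped ENNReal

variable {𝕜 : Type*} [RCLike 𝕜] {n r s m : ℕ}

/-- The Gevrey weights `t ^ k / (k!) ^ α`. -/
noncomputable def gevreyWeight (t : ℝ≥0∞) (α : ℝ) (k : ℕ) : ℝ≥0∞ :=
  t ^ k * ((k.factorial : ℝ≥0∞)⁻¹) ^ α

theorem isDecaying_gevreyWeight {t : ℝ≥0∞} (ht : t ≠ 0) {α : ℝ} (hα : 0 ≤ α) :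
    IsDecaying t (gevreyWeight t α) where
  zero_le_one := by simp [gevreyWeight]
  ne_zero i := by
    refine mul_ne_zero (pow_ne_zero _ ht) (ENNReal.rpow_pos ?_ ?_).ne'
    · exact ENNReal.inv_pos.mpr (ENNReal.natCast_ne_top _)
    · exact ENNReal.inv_ne_top.mpr (by exact_mod_cast Nat.factorial_ne_zero i)
  add_le_mul i j := by
    have h : (((i + j).factorial : ℝ≥0∞)⁻¹) ^ α ≤
        ((i.factorial : ℝ≥0∞)⁻¹) ^ α * ((j.factorial : ℝ≥0∞)⁻¹) ^ α := by
      rw [← ENNReal.mul_rpow_of_nonneg _ _ hα, ← ENNReal.mul_inv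
        (Or.inl (by exact_mod_cast Nat.factorial_ne_zero i))
        (Or.inl (ENNReal.natCast_ne_top _))]
      refine ENNReal.rpow_le_rpow (ENNReal.inv_le_inv.mpr ?_) hα
      exact_mod_cast Nat.le_of_dvd (Nat.factorial_pos _)
        (Nat.factorial_mul_factorial_dvd_factorial_add i j)
    calc gevreyWeight t α (i + j) ≤ t ^ (i + j) *
          (((i.factorial : ℝ≥0∞)⁻¹) ^ α * ((j.factorial : ℝ≥0∞)⁻¹) ^ α) := by
          unfold gevreyWeight; gcongr
      _ = _ := by rw [gevreyWeight, gevreyWeight, pow_add]; ring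
  add_le_pow_mul i j := by
    have h : (((i + j).factorial : ℝ≥0∞)⁻¹) ^ α ≤ ((j.factorial : ℝ≥0∞)⁻¹) ^ α := by
      refine ENNReal.rpow_le_rpow (ENNReal.inv_le_inv.mpr ?_) hα
      exact_mod_cast Nat.factorial_le (Nat.le_add_left j i)
    calc gevreyWeight t α (i + j) ≤ t ^ (i + j) * ((j.factorial : ℝ≥0∞)⁻¹) ^ α := by
          unfold gevreyWeight; gcongr
      _ = _ := by rw [gevreyWeight, pow_add]; ring

/-- Since `L + 1 + e ≤ (L + 1) * (e + 1)`, the extra factor `(e + 1)^α` in the factorial absorbs the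
growth; the spare `t` is what makes the bootstrap close. -/
theorem rpow_mul_gevreyWeight_succ_le (t : ℝ≥0∞) {α : ℝ} (hα : 0 ≤ α) (L e : ℕ) :
    ((L + 1 + e : ℕ) : ℝ≥0∞) ^ α * gevreyWeight t α (e + 1) ≤
      ((L + 1 : ℕ) : ℝ≥0∞) ^ α * t * gevreyWeight t α e := by
  have he0 : ((e + 1 : ℕ) : ℝ≥0∞) ≠ 0 := by exact_mod_cast Nat.succ_ne_zero e
  have het : ((e + 1 : ℕ) : ℝ≥0∞) ≠ ∞ := ENNReal.natCast_ne_top _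
  have h1 : ((L + 1 + e : ℕ) : ℝ≥0∞) ^ α * (((e + 1 : ℕ) : ℝ≥0∞)⁻¹) ^ α ≤
      ((L + 1 : ℕ) : ℝ≥0∞) ^ α := by
    rw [← ENNReal.mul_rpow_of_nonneg _ _ hα]
    refine ENNReal.rpow_le_rpow ?_ hα
    rw [← div_eq_mul_inv]
    refine ENNReal.div_le_of_le_mul ?_
    exact_mod_cast (by nlinarith [Nat.zero_le (L * e)] : L + 1 + e ≤ (L + 1) * (e + 1))
  have h2 : gevreyWeight t α (e + 1) =
      (((e + 1 : ℕ) : ℝ≥0∞)⁻¹) ^ α * (t * gevreyWeight t α e) := by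
    rw [gevreyWeight, gevreyWeight, Nat.factorial_succ, Nat.cast_mul,
      ENNReal.mul_inv (Or.inl he0) (Or.inl het), ENNReal.mul_rpow_of_nonneg _ _ hα, pow_succ]
    ring
  rw [h2, ← mul_assoc, mul_assoc (((L + 1 : ℕ) : ℝ≥0∞) ^ α)]
  gcongr

theorem weightedSum_degree (ω : ℕ → ℝ≥0∞) (f : FSeries 𝕜 n) :
    weightedSum (fun Q => ω Q.degree) f = ∑' d, ENNReal.ofReal (homNorm d f) * ω d := by
  rw [weightedSum, ← (Equiv.sigmaFiberEquiv (fun Q : Fin n →₀ ℕ => Q.degree)).tsum_eq,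
    ENNReal.tsum_sigma']
  refine tsum_congr fun d => ?_
  have h1 : ∀ b : {Q : Fin n →₀ ℕ // Q.degree = d},
      ‖coeff ((Equiv.sigmaFiberEquiv fun Q : Fin n →₀ ℕ => Q.degree) ⟨d, b⟩) f‖ₑ *
        ω ((Equiv.sigmaFiberEquiv fun Q : Fin n →₀ ℕ => Q.degree) ⟨d, b⟩).degree =
      ‖coeff b.1 f‖ₑ * ω d := by
    rintro ⟨b, rfl⟩
    rfl
  simp_rw [h1]
  rw [ENNReal.tsum_mul_right]
  congr 1
  have h2 : {Q : Fin n →₀ ℕ | Q.degree = d} =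
      (Finset.finsuppAntidiag (Finset.univ : Finset (Fin n)) d : Set (Fin n →₀ ℕ)) := by
    ext Q
    rw [Finset.mem_coe, mem_finsuppAntidiag_univ, Set.mem_ofPred_eq]
  calc ∑' b : {Q : Fin n →₀ ℕ | Q.degree = d}, ‖coeff b.1 f‖ₑ
      = ∑ Q ∈ Finset.finsuppAntidiag (Finset.univ : Finset (Fin n)) d, ‖coeff Q f‖ₑ := by
        rw [h2]
        exact Finset.tsum_subtype _ fun Q => ‖coeff Q f‖ₑ
    _ = _ := by
        rw [homNorm, ENNReal.ofReal_sum_of_nonneg fun _ _ => norm_nonneg _]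
        exact Finset.sum_congr rfl fun Q _ => (ofReal_norm _).symm

/-- Multiplying the big denominators estimate by `k ^ m` leaves `k ^ α`. With `k = e + q + 2` the
source index is `e + 1` and the image index `e`, so one step of the Gevrey weight pays for `k ^ α`
and yields the factor `t`. -/
theorem weightedSum_sourceWeight_le {f : FSeries 𝕜 n} {G : FTuple 𝕜 n s} {q : ℕ} {C α : ℝ}
    (hα : 0 ≤ α) (hC : 0 ≤ C) (t : ℝ≥0∞)
    (hf : ∀ Q : Fin n →₀ ℕ, Q.degree ≤ m + (q + 1) → coeff Q f = 0)
    (hfG : ∀ k, q + 1 < k →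
      homNorm (k + m) f ≤ C * tupleHomNorm (k + q) G / (k : ℝ) ^ ((m : ℝ) - α)) :
    weightedSum (sourceWeight (gevreyWeight t α) m (q + 1)) f ≤
      ENNReal.ofReal C * ((q + 2 : ℕ) : ℝ≥0∞) ^ α * t *
        ∑ l, weightedSum (imageWeight (gevreyWeight t α) q) (G l) := by
  set h := gevreyWeight t α
  set D : ℝ≥0∞ := ENNReal.ofReal C * ((q + 2 : ℕ) : ℝ≥0∞) ^ α * t
  have hsrc := weightedSum_degree
    (fun d => ((d - m : ℕ) : ℝ≥0∞) ^ m * h (d - m - (q + 1))) f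
  have himg : ∀ l, weightedSum (imageWeight h q) (G l) =
      ∑' d, ENNReal.ofReal (homNorm d (G l)) *
        if 2 * (q + 1) ≤ d then h (d - 2 * (q + 1)) else 0 := fun l =>
    weightedSum_degree (fun d => if 2 * (q + 1) ≤ d then h (d - 2 * (q + 1)) else 0) (G l)
  have hterm : ∀ e, ENNReal.ofReal (homNorm (e + (m + q + 2)) f) *
      (((e + (m + q + 2) - m : ℕ) : ℝ≥0∞) ^ m * h (e + (m + q + 2) - m - (q + 1))) ≤
      D * ∑ l, ENNReal.ofReal (homNorm (e + 2 * (q + 1)) (G l)) * h e := by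
    intro e
    set k := e + (q + 2) with hk
    have hkpos : (0 : ℝ) < k := by rw [hk]; positivity
    have h1 := hfG k (by omega)
    rw [show e + (m + q + 2) = k + m by omega, show k + m - m = k by omega,
      show k - (q + 1) = e + 1 by omega, show e + 2 * (q + 1) = k + q by omega]
    have hreal : homNorm (k + m) f * (k : ℝ) ^ m ≤
        C * (∑ l, homNorm (k + q) (G l)) * (k : ℝ) ^ α := by
      calc homNorm (k + m) f * (k : ℝ) ^ m
          ≤ C * tupleHomNorm (k + q) G / (k : ℝ) ^ ((m : ℝ) - α) * (k : ℝ) ^ m := by gcongr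
        _ = C * tupleHomNorm (k + q) G * (k : ℝ) ^ α := by
            rw [Real.rpow_sub hkpos, Real.rpow_natCast]
            field_simp
        _ ≤ _ := by gcongr; exact tupleHomNorm_le_sum _ _
    have henn : ENNReal.ofReal (homNorm (k + m) f) * (k : ℝ≥0∞) ^ m ≤
        ENNReal.ofReal C * (∑ l, ENNReal.ofReal (homNorm (k + q) (G l))) * (k : ℝ≥0∞) ^ α := by
      have h2 := ENNReal.ofReal_le_ofReal hreal
      rwa [ENNReal.ofReal_mul (homNorm_nonneg _ _), ENNReal.ofReal_pow hkpos.le,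
        ENNReal.ofReal_mul (mul_nonneg hC (Finset.sum_nonneg fun _ _ => homNorm_nonneg _ _)),
        ENNReal.ofReal_mul hC, ENNReal.ofReal_sum_of_nonneg fun _ _ => homNorm_nonneg _ _,
        ← ENNReal.ofReal_rpow_of_pos hkpos, ENNReal.ofReal_natCast] at h2
    have h3 := rpow_mul_gevreyWeight_succ_le t hα (q + 1) e
    rw [show q + 1 + 1 + e = k by omega] at h3
    rw [← mul_assoc, ← Finset.sum_mul]
    calc _ ≤ ENNReal.ofReal C * (∑ l, ENNReal.ofReal (homNorm (k + q) (G l))) *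
          (k : ℝ≥0∞) ^ α * h (e + 1) := by gcongr
      _ = ENNReal.ofReal C * (∑ l, ENNReal.ofReal (homNorm (k + q) (G l))) *
          ((k : ℝ≥0∞) ^ α * h (e + 1)) := by ring
      _ ≤ ENNReal.ofReal C * (∑ l, ENNReal.ofReal (homNorm (k + q) (G l))) *
          (((q + 1 + 1 : ℕ) : ℝ≥0∞) ^ α * t * h e) := by gcongr
      _ = _ := by ring
  have hzero : ∀ d ∈ Finset.range (m + q + 2), ENNReal.ofReal (homNorm d f) *
      (((d - m : ℕ) : ℝ≥0∞) ^ m * h (d - m - (q + 1))) = 0 := by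
    intro d hd
    rw [Finset.mem_range] at hd
    rw [homNorm, Finset.sum_eq_zero, ENNReal.ofReal_zero, zero_mul]
    intro Q hQ
    rw [mem_finsuppAntidiag_univ] at hQ
    rw [hf Q (by omega), norm_zero]
  calc weightedSum (sourceWeight h m (q + 1)) f
      = ∑' d, ENNReal.ofReal (homNorm d f) *
        (((d - m : ℕ) : ℝ≥0∞) ^ m * h (d - m - (q + 1))) := hsrc
    _ = ∑' e, ENNReal.ofReal (homNorm (e + (m + q + 2)) f) *
        (((e + (m + q + 2) - m : ℕ) : ℝ≥0∞) ^ m * h (e + (m + q + 2) - m - (q + 1))) := by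
        rw [← ENNReal.summable.sum_add_tsum_nat_add' (k := m + q + 2),
          Finset.sum_eq_zero hzero, zero_add]
    _ ≤ ∑' e, D * ∑ l, ENNReal.ofReal (homNorm (e + 2 * (q + 1)) (G l)) * h e :=
        ENNReal.tsum_le_tsum hterm
    _ = D * ∑ l, ∑' e, ENNReal.ofReal (homNorm (e + 2 * (q + 1)) (G l)) * h e := by
        rw [ENNReal.tsum_mul_left, Summable.tsum_finsetSum fun _ _ => ENNReal.summable]
    _ ≤ _ := by
        gcongr with l
        rw [himg]
        refine le_trans (le_of_eq (tsum_congr fun e => ?_))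
          (ENNReal.tsum_comp_le_tsum_of_injective (add_left_injective (2 * (q + 1))) _)
        simp

/-- The part of a tuple consisting of the terms of degree `> a` and `≤ b`. -/
noncomputable def band (a b : ℕ) (F : FTuple 𝕜 n r) : FTuple 𝕜 n r :=
  fun j Q => if a < Q.degree ∧ Q.degree ≤ b then coeff Q (F j) else 0

theorem coeff_band (a b : ℕ) (F : FTuple 𝕜 n r) (j : Fin r) (Q : Fin n →₀ ℕ) :
    coeff Q (band a b F j) = if a < Q.degree ∧ Q.degree ≤ b then coeff Q (F j) else 0 :=
  rfl

theorem band_mem_filt (L b : ℕ) (F : FTuple 𝕜 n r) : band (m + L) b F ∈ filt 𝕜 n r m L :=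
  mem_filt_iff.mpr fun j Q hQ => by rw [coeff_band, if_neg (by omega)]

/-- The finitely many coefficients of degree at most `m + L` only affect the constant `M`. -/
theorem isGevrey_of_weightedSum_le {f : FSeries 𝕜 n} {α : ℝ} (hα : 0 ≤ α) {t : ℝ≥0∞}
    (ht0 : t ≠ 0) (ht1 : t ≤ 1) {L : ℕ}
    (hf : ∀ Q : Fin n →₀ ℕ, m + L < Q.degree →
      ‖coeff Q f‖ₑ * sourceWeight (gevreyWeight t α) m L Q ≤ 1) : IsGevrey α f := by
  have httop : t ≠ ∞ := ne_top_of_le_ne_top ENNReal.one_ne_top ht1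
  set c := t.toReal with hc
  have hc0 : 0 < c := ENNReal.toReal_pos ht0 httop
  have hc1 : c ≤ 1 := by simpa using ENNReal.toReal_mono ENNReal.one_ne_top ht1
  have hcinv : 1 ≤ c⁻¹ := (one_le_inv₀ hc0).mpr hc1
  have hfin : {Q : Fin n →₀ ℕ | Q.degree ≤ m + L}.Finite := Finsupp.finite_of_degree_le _
  set M : ℝ := 1 + ∑ Q ∈ hfin.toFinset, ‖coeff Q f‖ with hM
  have hM1 : 1 ≤ M := le_add_of_nonneg_right (Finset.sum_nonneg fun _ _ => norm_nonneg _)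
  refine ⟨M, by linarith, c⁻¹, by positivity, fun Q => ?_⟩
  have hfac : ∀ k : ℕ, (1 : ℝ) ≤ ((k.factorial : ℕ) : ℝ) ^ α := fun k =>
    Real.one_le_rpow (by exact_mod_cast Nat.factorial_pos k) hα
  rcases Nat.lt_or_ge (m + L) Q.degree with hQ | hQ
  · have h1 := hf Q hQ
    set k := Q.degree - m with hk
    have hk1 : (1 : ℝ≥0∞) ≤ ((k : ℕ) : ℝ≥0∞) ^ m :=
      one_le_pow₀ (by exact_mod_cast (by omega : 1 ≤ k))
    have h2 : ‖coeff Q f‖ₑ * gevreyWeight t α (k - L) ≤ 1 := by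
      refine le_trans ?_ h1
      rw [sourceWeight]
      gcongr
      exact le_mul_of_one_le_left' hk1
    have h3 : ‖coeff Q f‖ * (c ^ (k - L) * (((k - L).factorial : ℝ)⁻¹) ^ α) ≤ 1 := by
      have h4 := ENNReal.toReal_mono ENNReal.one_ne_top h2
      simpa [gevreyWeight, ENNReal.toReal_mul, ← ENNReal.toReal_rpow] using h4
    have hfpos : (0 : ℝ) < ((k - L).factorial : ℝ) ^ α := by positivity
    rw [Real.inv_rpow (by positivity)] at h3
    have h5 : ‖coeff Q f‖ ≤ c⁻¹ ^ (k - L) * ((k - L).factorial : ℝ) ^ α := by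
      calc ‖coeff Q f‖ = ‖coeff Q f‖ * (c ^ (k - L) * (((k - L).factorial : ℝ) ^ α)⁻¹) *
            (c⁻¹ ^ (k - L) * ((k - L).factorial : ℝ) ^ α) := by
            rw [inv_pow]
            field_simp
        _ ≤ 1 * (c⁻¹ ^ (k - L) * ((k - L).factorial : ℝ) ^ α) := by gcongr
        _ = _ := one_mul _
    calc ‖coeff Q f‖ ≤ c⁻¹ ^ (k - L) * ((k - L).factorial : ℝ) ^ α := h5
      _ ≤ c⁻¹ ^ Q.degree * ((Q.degree.factorial : ℕ) : ℝ) ^ α := by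
          gcongr
          · omega
          · omega
      _ ≤ M * c⁻¹ ^ Q.degree * ((Q.degree.factorial : ℕ) : ℝ) ^ α := by
          rw [mul_assoc]
          exact le_mul_of_one_le_left (by positivity) hM1
  · calc ‖coeff Q f‖ ≤ ∑ Q ∈ hfin.toFinset, ‖coeff Q f‖ :=
          Finset.single_le_sum (f := fun Q => ‖coeff Q f‖) (fun _ _ => norm_nonneg _)
            (by simpa using hQ)
      _ ≤ M := by rw [hM]; linarith
      _ ≤ M * (c⁻¹ ^ Q.degree * ((Q.degree.factorial : ℕ) : ℝ) ^ α) :=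
          le_mul_of_one_le_right (by linarith)
            (one_le_mul_of_one_le_of_one_le (one_le_pow₀ hcinv) (hfac _))
      _ = _ := by ring

theorem isGevrey_of_homNorm_le {q : ℕ} {C α : ℝ} (hα : 0 ≤ α) (hC : 0 ≤ C)
    {T : Unknown 𝕜 n r m → FTuple 𝕜 n s} (hT : IsRegularDifferentialAnalytic q T)
    (hTq : StrictlyIncreasesOrder q T) {F : Unknown 𝕜 n r m}
    (hF : ∀ (j : Fin r) (i : ℕ), 1 ≤ i →
      homNorm (i + m) (F.1 j) ≤ C * tupleHomNorm (i + q) (T F) / (i : ℝ) ^ ((m : ℝ) - α))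
    (j : Fin r) : IsGevrey α (F.1 j) := by
  obtain ⟨W, hW, hTW, hord⟩ := hT
  set L := q + 1 with hL
  set P : Unknown 𝕜 n r m := ⟨band (m + 0) (m + L) F.1, band_mem_filt 0 _ _⟩ with hP
  have hPc : ∀ j Q, coeff Q (P.1 j) =
      if m + 0 < Q.degree ∧ Q.degree ≤ m + L then coeff Q (F.1 j) else 0 := fun _ _ => rfl
  have hcore := fun i => exists_weightedSum_compJet_le (hW i).1 P (N := m + L)
    (fun j Q hQ => by rw [hPc, if_neg (by omega)]) (hord P i)
  choose t ht0 ht1 A hA hbound using hcore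
  set D : ℝ≥0∞ := ENNReal.ofReal C * ((q + 2 : ℕ) : ℝ≥0∞) ^ α * ∑ l, A l with hD
  have hDtop : D ≠ ∞ := by
    refine ENNReal.mul_ne_top (ENNReal.mul_ne_top ENNReal.ofReal_ne_top ?_)
      (ENNReal.sum_ne_top.mpr fun l _ => hA l)
    exact ENNReal.rpow_ne_top_of_nonneg hα (ENNReal.natCast_ne_top _)
  -- Small enough for the composition estimate of every component, and for `D * u ≤ 1`; the outer
  -- `1` also covers an empty family of components.
  set u : ℝ≥0∞ := min (min 1 (Finset.univ.inf t)) (1 + D)⁻¹ with hu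
  have hu0 : u ≠ 0 := by
    refine (lt_min (lt_min one_pos ?_) ?_).ne'
    · exact (Finset.lt_inf_iff ENNReal.zero_lt_top).mpr fun l _ => pos_iff_ne_zero.mpr (ht0 l)
    · exact ENNReal.inv_pos.mpr (ENNReal.add_ne_top.mpr ⟨ENNReal.one_ne_top, hDtop⟩)
  have hu1 : u ≤ 1 := (min_le_left _ _).trans (min_le_left _ _)
  have hut : ∀ l, u ≤ t l := fun l =>
    ((min_le_left _ _).trans (min_le_right _ _)).trans (Finset.inf_le (Finset.mem_univ l))
  have huD : D * u ≤ 1 := by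
    calc D * u ≤ (1 + D) * (1 + D)⁻¹ := by
          gcongr
          · exact le_add_self
          · exact min_le_right _ _
      _ ≤ 1 := ENNReal.mul_inv_le_one _
  set h := gevreyWeight u α with hh
  have hdec : IsDecaying u h := isDecaying_gevreyWeight hu0 hα
  -- Working with truncations avoids presupposing that the full norm is finite; the bound `1` is
  -- uniform in `I`.
  have hmain : ∀ I j, weightedSum (sourceWeight h m L) (band (m + L) (m + I) F.1 j) ≤ 1 := by
    intro I
    induction I with
    | zero =>
      intro j
      have h0 : band (m + L) (m + 0) F.1 j = 0 := by
        ext Q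
        rw [coeff_band, if_neg (by omega), map_zero]
      rw [h0]
      simp [weightedSum]
    | succ I ih =>
      intro j
      set G : FTuple 𝕜 n r := band (m + L) (m + I) F.1 with hG
      have hGL : G ∈ filt 𝕜 n r m L := band_mem_filt L _ _
      -- `H` is `F` cut off at degree `m + I`. As `T` is strictly increasing, `T F` and `T H` agree
      -- up to degree `I + 1 + q`, exactly what controls the next degree `m + I + 1` of `F`.
      set H : Unknown 𝕜 n r m := P + ⟨G, filt_anti (Nat.zero_le L) hGL⟩ with hH
      have hHc : H.1 = P.1 + G := rfl
      have hFH : F.1 - H.1 ∈ filt 𝕜 n r m I := by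
        refine mem_filt_iff.mpr fun j Q hQ => ?_
        rw [hHc, Pi.sub_apply, Pi.add_apply, map_sub, map_add, hPc, hG, coeff_band]
        rcases Nat.lt_or_ge m Q.degree with h1 | h1
        · rcases Nat.lt_or_ge (m + L) Q.degree with h2 | h2
          · rw [if_neg (by omega), if_pos (by omega), zero_add, sub_self]
          · rw [if_pos (by omega), if_neg (by omega), add_zero, sub_self]
        · rw [if_neg (by omega), if_neg (by omega), mem_filt_iff.mp F.2 j Q (by omega)]
          simp
      have hTFH : ∀ l (Q : Fin n →₀ ℕ), Q.degree ≤ I + 1 + q →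
          coeff Q (T F l) = coeff Q (T H l) := by
        intro l Q hQ
        have h1 := natCast_lt_order_iff.mp (hTq F H I hFH l) Q hQ
        rwa [map_sub, sub_eq_zero] at h1
      have hstep := weightedSum_sourceWeight_le (m := m) (q := q) hα hC u
        (f := band (m + L) (m + (I + 1)) F.1 j) (G := T H)
        (mem_filt_iff.mp (band_mem_filt L _ _) j) (fun k hk => by
          rcases Nat.lt_or_ge (I + 1) k with hkI | hkI
          · have h0 : homNorm (k + m) (band (m + L) (m + (I + 1)) F.1 j) = 0 := by
              refine Finset.sum_eq_zero fun Q hQ => ?_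
              rw [mem_finsuppAntidiag_univ] at hQ
              rw [coeff_band, if_neg (by omega), norm_zero]
            rw [h0]
            have : 0 ≤ tupleHomNorm (k + q) (T H) := Real.iSup_nonneg fun l => homNorm_nonneg _ _
            positivity
          · rw [homNorm_congr (g := F.1 j) fun Q hQ => by
              rw [coeff_band, if_pos (by omega)],
              ← tupleHomNorm_congr (F := T F) fun l Q hQ => hTFH l Q (by omega)]
            exact hF j k (by omega))
      refine hstep.trans ?_
      have hsum : ∑ l, weightedSum (imageWeight h q) (T H l) ≤ ∑ l, A l := by
        refine Finset.sum_le_sum fun l _ => ?_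
        rw [hTW, hHc]
        exact hbound l h (hdec.mono (hut l)) G hGL ih
      calc _ ≤ ENNReal.ofReal C * ((q + 2 : ℕ) : ℝ≥0∞) ^ α * u * ∑ l, A l := by gcongr
        _ = D * u := by rw [hD]; ring
        _ ≤ 1 := huD
  refine isGevrey_of_weightedSum_le (m := m) (L := L) hα hu0 hu1 fun Q hQ => ?_
  -- Cutting off at `m + Q.degree` keeps the term `Q`, which is then bounded by the whole sum.
  refine le_trans ?_ (hmain Q.degree j)
  have hQc : coeff Q (band (m + L) (m + Q.degree) F.1 j) = coeff Q (F.1 j) := by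
    rw [coeff_band, if_pos (by omega)]
  rw [← hQc]
  exact ENNReal.le_tsum
    (f := fun Q' => ‖coeff Q' (band (m + L) (m + Q.degree) F.1 j)‖ₑ * sourceWeight h m L Q') Q

end Gevrey

end BigDenominators

/-! ### Solution of the equation and its Gevrey bound -/

theorem theorem4p2 {𝕜 : Type*} [RCLike 𝕜] (n r s m : ℕ) (α : ℝ) (hα : 0 < α)
    (S : BigDenominators.Unknown 𝕜 n r m →ₗ[𝕜] BigDenominators.FTuple 𝕜 n s)
    (T : BigDenominators.Unknown 𝕜 n r m → BigDenominators.FTuple 𝕜 n s)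
    (π : BigDenominators.FTuple 𝕜 n s →ₗ[𝕜] BigDenominators.FTuple 𝕜 n s)
    (h : BigDenominators.RelativeBigDenominators α S T π) :
    ∃ F : BigDenominators.Unknown 𝕜 n r m,
      S F = π (T F) ∧ ∀ j, BigDenominators.IsGevrey α (F.1 j) := by
  obtain ⟨q, hT, hTq, hT0, hS, hπ, Sinv, hSinv, C, hC, hest⟩ := h
  have hB : BigDenominators.SolvesWithBound q C ((m : ℝ) - α)
      (fun G => Sinv ⟨π G, hπ.map_mem G⟩) := fun G hG j i hi => hest G hG _ rfl j i hi
  -- Comparison with `T 0` puts every `T F` in the range of orders where the estimate on the right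
  -- inverse applies.
  have hTord : ∀ F l, (q : ℕ∞) < (T F l).order := by
    intro F l
    rw [BigDenominators.natCast_lt_order_iff]
    intro Q hQ
    have h1 := BigDenominators.natCast_lt_order_iff.mp
      (hTq F 0 0 (sub_mem F.2 (0 : BigDenominators.Unknown 𝕜 n r m).2) l) Q (by omega)
    rwa [map_sub, BigDenominators.natCast_lt_order_iff.mp (hT0 l) Q hQ, sub_zero] at h1
  obtain ⟨F, hF⟩ := BigDenominators.exists_fixedPoint
    (Ψ := fun F => BigDenominators.degreewise q (fun G => Sinv ⟨π G, hπ.map_mem G⟩) (T F))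
    fun F G k hFG => BigDenominators.degreewise_sub_mem q _ fun l Q hQ => by
      have h1 := BigDenominators.natCast_lt_order_iff.mp (hTq F G k hFG l) Q hQ
      rwa [map_sub, sub_eq_zero] at h1
  refine ⟨F, ?_, ?_⟩
  · rw [← BigDenominators.map_degreewise hB hS (fun G => hSinv _) (hTord F), hF]
  · refine BigDenominators.isGevrey_of_homNorm_le hα.le hC.le hT hTq fun j i hi => ?_
    have h1 := hB.degreewise (T F) (hTord F) j i hi
    rwa [hF] at h1
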